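/- Let $s\in(0,\frac12)\cup(\frac12,1)$, $L,\delta>0$, $\alpha\in(\max(0,2s-1),1]$, $\kappa\in\mathbb{R}$, $\Omega_2=[-L,L]^2$, $\Omega_2^\delta=(-L-\delta,L+\delta)^2$. Let $g\in L^\infty(\mathbb{R}^2)$ have bounded support with $g=0$ on $\Omega_2$, and let $u:\mathbb{R}^2\to\mathbb{R}$ satisfy $u=g$ on $\mathbb{R}^2\setminus\Omega_2$ and $u\in C^{1,\alpha}(\bar\Omega_2^\delta)$. Put $c_{2,s}=\frac{2^{2s}s\Gamma(1+s)}{\pi\Gamma(1-s)}$, $c_{2,s-1}=-\frac{2^{2s-2}(s-1)\Gamma(s)}{\pi\Gamma(2-s)}$ and $$(-\Delta)^su(\mathbf{x})=c_{2,s}\,\mathrm{P.V.}\int_{\mathbb{R}^2}\frac{u(\mathbf{x})-u(\mathbf{y})}{|\mathbf{x}-\mathbf{y}|^{2+2s}}\,d\mathbf{y}.$$ For $N\ge1$ let $h=2L/N$, $\mathbf{x}_{i,j}=(-L+ih,-L+jh)$ for $i,j\in\mathbb{Z}$, and $v_{i,j}=v(\mathbf{x}_{i,j})$ for a function $v$.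 Let $\bar\phi_2(\xi,\eta)=(1-|\xi|/h)(1-|\eta|/h)$ on $(-h,h)^2$ and $0$ elsewhere, and let $\phi_{p,q}=\bar\phi_2(\cdot-\mathbf{x}_{p,q})\,\chi_{\Omega_2}$. Call $\mathbf{x}_{i,j}$ an interior node if $0<i,j<N$, and a boundary node if $0\le i,j\le N$ and $ij(i-N)(j-N)=0$. Put $$\bar\omega_{k,l}=c_{2,s-1}\int_{\mathbb{R}^2}|(kh,lh)+\mathbf{z}|^{-2s}\bar\phi_2(\mathbf{z})\,d\mathbf{z},$$ $$R_{i,j}=c_{2,s-1}\int_{\mathbb{R}^2}|\mathbf{x}_{i,j}-\mathbf{y}|^{-2s}g(\mathbf{y})\,d\mathbf{y}+c_{2,s-1}\sum_{\mathbf{x}_{p,q}\text{ boundary node}}u_{p,q}\int_{\mathbb{R}^2}|\mathbf{x}_{i,j}-\mathbf{y}|^{-2s}\phi_{p,q}(\mathbf{y})\,d\mathbf{y},$$ $$(-\Delta)_{h,1}v_{i,j}=-\frac{v_{i-1,j}+v_{i+1,j}+v_{i,j+1}+v_{i,j-1}-4v_{i,j}}{h^2},$$ $$(-\Delta)_{h,2}v_{i,j}=-\frac{v_{i-1,j-1}+v_{i+1,j-1}+v_{i-1,j+1}+v_{i+1,j+1}-4v_{i,j}}{2h^2}.$$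 Given $\theta\in[0,1]$ and $c_{0,0}\ge0$ (possibly depending on $h$), let $D_h=\theta(-\Delta)_{h,1}+(1-\theta)(-\Delta)_{h,2}$. Let $\bar\omega^M_{0,0}=\bar\omega_{0,0}+c_{0,0}$ and $\bar\omega^M_{k,l}=\bar\omega_{k,l}$ for $(k,l)\neq(0,0)$, let $w^M=D_h\bar\omega^M$, and let $R^M_{i,j}=R_{i,j}+c_{0,0}u_{i,j}$ at boundary nodes and $R^M_{i,j}=R_{i,j}$ otherwise (so that the correction $c_{0,0}u_{i,j}$ is applied at boundary nodes too). The modified scheme at interior nodes is $$(-\Delta)^s_{h,M}u_{i,j}=\sum_{p,q=1}^{N-1}w^M_{p-i,q-j}u_{p,q}+D_hR^M_{i,j}.$$ For arrays $e$ on the interior nodes let $\|e\|_\infty=\max|e_{i,j}|$ and $\|e\|_2=(h^2\sum|e_{i,j}|^2)^{1/2}$. Then the principal value $(-\Delta)^su(\mathbf{x})$ exists for every $\mathbf{x}\in\Omega_2$, and there is a constant $C>0$, independent of $N$, $h$, $\theta$ and $c_{0,0}$, such that for all $N\ge1$ with $4h<\delta$, all $\theta\in[0,1]$ and all $c_{0,0}$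 with $0\le c_{0,0}\le\kappa h^{2-2s}$, $$\|((-\Delta)^s-(-\Delta)^s_{h,M})u\|_\infty\le Ch^{1+\alpha-2s},\qquad \|((-\Delta)^s-(-\Delta)^s_{h,M})u\|_2\le Ch^{1+\alpha-2s}.$$ If $u=0$ on $\partial\Omega_2$, the same two estimates hold for the scheme in which $R$ is used in place of $R^M$. -/

import Mathlib

open MeasureTheory Filter Topology

noncomputable section

namespace FracLap2D

/-- The plane `ℝ²` with its Euclidean norm and Lebesgue measure. -/
abbrev Plane := EuclideanSpace ℝ (Fin 2)

/-- The normalising constant `c_{n,s} = 2^{2s} s Γ(n/2+s) / (π^{n/2} Γ(1-s))` for `0 < s < 1`. -/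
def fracConst (n : ℕ) (s : ℝ) : ℝ :=
  (2 : ℝ) ^ (2 * s) * s * Real.Gamma (n / 2 + s) /
    (Real.pi ^ ((n : ℝ) / 2) * Real.Gamma (1 - s))

/-- The normalising constant
`c_{n,s'} = - 2^{2s'} s' Γ(n/2+s') / (π^{n/2} Γ(1-s'))` for `s' < 0`. -/
def rieszConst (n : ℕ) (s' : ℝ) : ℝ :=
  -((2 : ℝ) ^ (2 * s') * s' * Real.Gamma (n / 2 + s') /
    (Real.pi ^ ((n : ℝ) / 2) * Real.Gamma (1 - s')))

/-- `(-Δ)^s u(x)` exists as a principal value integral on `ℝ²` and equals `ℓ`: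
the integrals truncated at `|x - y| > ε` converge absolutely and tend to `ℓ` as `ε ↓ 0`. -/
def HasFracLaplacian (s : ℝ) (u : Plane → ℝ) (x : Plane) (ℓ : ℝ) : Prop :=
  (∀ ε : ℝ, 0 < ε →
    IntegrableOn (fun y => (u x - u y) / ‖x - y‖ ^ (2 + 2 * s)) {y | ε < ‖x - y‖} volume) ∧
  Tendsto
    (fun ε : ℝ => fracConst 2 s *
      ∫ y in {y : Plane | ε < ‖x - y‖}, (u x - u y) / ‖x - y‖ ^ (2 + 2 * s))
    (𝓝[>] 0) (𝓝 ℓ)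

/-- The closed square `Ω₂ = [-L, L] × [-L, L]`. -/
def closedSquare (L : ℝ) : Set Plane := {x | ∀ k, -L ≤ x k ∧ x k ≤ L}

/-- The open square `(-a, a) × (-a, a)`. -/
def openSquare (a : ℝ) : Set Plane := {x | ∀ k, -a < x k ∧ x k < a}

/-- `u ∈ C^{1,α}` up to the boundary of the bounded convex open set `U`: `u` is `C¹` in `U`,
continuous on the closure, and its derivative is `α`-Hölder on `U` (hence is bounded and extends
to an `α`-Hölder function on the closure). -/
def C1Holder (α : ℝ) (u : Plane → ℝ) (U : Set Plane) : Prop :=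
  ContDiffOn ℝ 1 u U ∧ ContinuousOn u (closure U) ∧
    ∃ K : ℝ, ∀ x ∈ U, ∀ y ∈ U, ‖fderiv ℝ u x - fderiv ℝ u y‖ ≤ K * ‖x - y‖ ^ α

/-- The mesh size `h = 2L/N`. -/
def mesh (L : ℝ) (N : ℕ) : ℝ := 2 * L / N

/-- The grid point `(x_i, y_j) = (-L + i h, -L + j h)`, for all integers `i, j`. -/
def gridPoint (L : ℝ) (N : ℕ) (i j : ℤ) : Plane :=
  !₂[-L + i * mesh L N, -L + j * mesh L N]

/-- The bilinear hat function `φ̄₂` of mesh size `h`. -/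
def hat (h : ℝ) (z : Plane) : ℝ :=
  open Classical in
  if z ∈ openSquare h then (1 - |z 0| / h) * (1 - |z 1| / h) else 0

/-- The Lagrange basis function `φ_{p,q}`: the hat function at the node `(x_p, y_q)`, restricted
to `I_{p,q} = [x_{p-1}, x_{p+1}] × [y_{q-1}, y_{q+1}] ∩ Ω₂`. -/
def basisFun (L : ℝ) (N : ℕ) (p q : ℤ) : Plane → ℝ :=
  Set.indicator
    ({z | ∀ k, |z k - gridPoint L N p q k| ≤ mesh L N} ∩ closedSquare L)
    (fun z => hat (mesh L N) (z - gridPoint L N p q))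

/-- The weights `ω̄_{k,l} = c_{2,s-1} ∬ |(kh, lh) + (ξ, η)|^{-2s} φ̄₂(ξ, η) dξ dη`. -/
def omegaBar (s L : ℝ) (N : ℕ) (k l : ℤ) : ℝ :=
  rieszConst 2 (s - 1) *
    ∫ ζ : Plane, ‖!₂[(k : ℝ) * mesh L N, (l : ℝ) * mesh L N] + ζ‖ ^ (-2 * s) * hat (mesh L N) ζ

/-- The modified weights: `c00` is added to `ω̄_{0,0}`, all other weights are unchanged. -/
def omegaBarM (s L : ℝ) (N : ℕ) (c00 : ℝ) (k l : ℤ) : ℝ :=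
  omegaBar s L N k l + if k = 0 ∧ l = 0 then c00 else 0

/-- The five-point discretization `(-Δ)_{h,1}`. -/
def negLap1 (h : ℝ) (v : ℤ → ℤ → ℝ) (i j : ℤ) : ℝ :=
  -((v (i - 1) j + v (i + 1) j + v i (j + 1) + v i (j - 1) - 4 * v i j) / h ^ 2)

/-- The diagonal five-point discretization `(-Δ)_{h,2}`. -/
def negLap2 (h : ℝ) (v : ℤ → ℤ → ℝ) (i j : ℤ) : ℝ :=
  -((v (i - 1) (j - 1) + v (i + 1) (j - 1) + v (i - 1) (j + 1) + v (i + 1) (j + 1)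
      - 4 * v i j) / (2 * h ^ 2))

/-- The combination `θ (-Δ)_{h,1} + (1 - θ) (-Δ)_{h,2}`. -/
def negLap (h θ : ℝ) (v : ℤ → ℤ → ℝ) (i j : ℤ) : ℝ :=
  θ * negLap1 h v i j + (1 - θ) * negLap2 h v i j

/-- The modified weights `w^M_{k,l} = (θ (-Δ)_{h,1} + (1 - θ) (-Δ)_{h,2}) ω̄^M_{k,l}`. -/
def weightM (s L : ℝ) (N : ℕ) (θ c00 : ℝ) : ℤ → ℤ → ℝ :=
  negLap (mesh L N) θ (omegaBarM s L N c00)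

/-- The indices `(p, q)`, `0 < p, q < N`, of the interior nodes. -/
def interiorIdx (N : ℕ) : Finset (ℤ × ℤ) :=
  Finset.Icc 1 ((N : ℤ) - 1) ×ˢ Finset.Icc 1 ((N : ℤ) - 1)

/-- The indices `(p, q)`, `0 ≤ p, q ≤ N`, with `p q (p - N) (q - N) = 0`, of the boundary nodes. -/
def boundaryIdx (N : ℕ) : Finset (ℤ × ℤ) :=
  (Finset.Icc 0 (N : ℤ) ×ˢ Finset.Icc 0 (N : ℤ)).filter
    (fun k => k.1 * k.2 * (k.1 - N) * (k.2 - N) = 0)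

/-- The contribution `R_{i,j}` of the exterior data and of the boundary nodes to the discretization
of `(-Δ)^{s-1} u` at the node `(x_i, y_j)`. -/
def remainder (s L : ℝ) (N : ℕ) (u g : Plane → ℝ) (i j : ℤ) : ℝ :=
  rieszConst 2 (s - 1) * (∫ y : Plane, ‖gridPoint L N i j - y‖ ^ (-2 * s) * g y) +
  rieszConst 2 (s - 1) * ∑ k ∈ boundaryIdx N,
    ∫ y : Plane, ‖gridPoint L N i j - y‖ ^ (-2 * s) *
      (u (gridPoint L N k.1 k.2) * basisFun L N k.1 k.2 y)

/-- `R_{i,j}` with the correction `c00` of the diagonal weight also applied at the boundary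
nodes: there the value `c00 * u(x_i, y_j)` is added. -/
def remainderM (s L : ℝ) (N : ℕ) (c00 : ℝ) (u g : Plane → ℝ) (i j : ℤ) : ℝ :=
  remainder s L N u g i j +
    if (i, j) ∈ boundaryIdx N then c00 * u (gridPoint L N i j) else 0

/-- The modified scheme at `(x_i, y_j)`, for given exterior and boundary contributions `R`:
`∑_{p,q=1}^{N-1} w^M_{p-i,q-j} u_{p,q} + (θ (-Δ)_{h,1} + (1 - θ) (-Δ)_{h,2}) R_{i,j}`. -/
def schemeM (s L : ℝ) (N : ℕ) (θ c00 : ℝ) (u : Plane → ℝ) (R : ℤ → ℤ → ℝ) (i j : ℤ) : ℝ :=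
  (∑ k ∈ interiorIdx N,
      weightM s L N θ c00 (k.1 - i) (k.2 - j) * u (gridPoint L N k.1 k.2)) +
    negLap (mesh L N) θ R i j

/-- The discrete `l^∞` norm over the interior nodes (the sup norm of a finite family). -/
def normSup (N : ℕ) (e : ℤ → ℤ → ℝ) : ℝ :=
  ‖fun k : interiorIdx N => e k.1.1 k.1.2‖

/-- The discrete `l²` norm `(h² ∑ |e_{i,j}|²)^{1/2}` over the interior nodes. -/
def normTwo (h : ℝ) (N : ℕ) (e : ℤ → ℤ → ℝ) : ℝ :=
  Real.sqrt (h ^ 2 * ∑ k ∈ interiorIdx N, e k.1 k.2 ^ 2)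

end FracLap2D

end

noncomputable section

namespace FracLap2D

/-! ### Second differences of powers of quadratic functions -/

/-! Away from the origin the Riesz kernel `|z|^{-2s}` has Laplacian `4s²|z|^{-2s-2}`, so formally
`(-Δ)^s u` is `-Δ` applied to the Riesz potential of `u`. The scheme replaces `-Δ` by a discrete
Laplacian and `u` by its bilinear interpolant `W`: by `schemeM_eq` it is exactly `D_h (c_{2,s-1}
|·|^{-2s} * W + c00 u)` at interior nodes. Both stencils are crosses along orthogonal directions `h
a`, `rot (h a)`, so one analysis covers them, and a convex combination covers every `θ`.

The error splits into three terms, each of order `h^{1+α-2s}`. (1) Discretizing the Laplacian with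
`u` itself (`abs_fracLap_add_le`): differences are moved onto the kernel and the integrals
symmetrized, so that only second differences of `u`, of size `|z|^{1+α}`, meet the truncation error
of the kernel. Homogeneity of that error gives the rate. Symmetrizing leaves no extra term because
the differenced kernel has mean zero (`integral_secDiff_kernel`). (2) Interpolation: `u - W` is
`O(h^{1+α})` uniformly (`abs_sub_interp_le`), and the differenced kernel divided by `h²` has `L¹`
norm of order `h^{-2s}`. (3) The correction: `c00 ≤ κ h^{2-2s}` multiplies a discrete Laplacian of
`u`, which is `O(h^{α-1})`. -/

theorem abs_le_of_hasDerivAt_of_abs_le {g g' : ℝ → ℝ} {C : ℝ}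
    (hg : ∀ t ∈ Set.Icc (0 : ℝ) 1, HasDerivAt g (g' t) t) (h0 : g 0 = 0)
    (hC : ∀ t ∈ Set.Icc (0 : ℝ) 1, |g' t| ≤ C) : ∀ t ∈ Set.Icc (0 : ℝ) 1, |g t| ≤ C := by
  intro t ht
  have h := Convex.norm_image_sub_le_of_norm_hasDerivWithin_le
    (fun x hx => (hg x hx).hasDerivWithinAt) hC (convex_Icc 0 1)
    (Set.left_mem_Icc.2 zero_le_one) ht
  rw [h0, sub_zero, sub_zero, Real.norm_eq_abs, Real.norm_eq_abs, abs_of_nonneg ht.1] at h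
  have hC0 : 0 ≤ C := (abs_nonneg _).trans (hC t ht)
  nlinarith [ht.2]

/-- Symmetrizing in `t` removes the odd Taylor terms. The bound `2M` on the symmetrized fourth
derivative is integrated four times from `0`; on `[0,1]` no integration increases it, so the sharp
constant is not pursued. -/
theorem abs_secondDiff_sub_le {f f₁ f₂ f₃ f₄ : ℝ → ℝ} {M : ℝ}
    (h₁ : ∀ t ∈ Set.Icc (-1 : ℝ) 1, HasDerivAt f (f₁ t) t)
    (h₂ : ∀ t ∈ Set.Icc (-1 : ℝ) 1, HasDerivAt f₁ (f₂ t) t)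
    (h₃ : ∀ t ∈ Set.Icc (-1 : ℝ) 1, HasDerivAt f₂ (f₃ t) t)
    (h₄ : ∀ t ∈ Set.Icc (-1 : ℝ) 1, HasDerivAt f₃ (f₄ t) t)
    (hM : ∀ t ∈ Set.Icc (-1 : ℝ) 1, |f₄ t| ≤ M) :
    |f 1 + f (-1) - 2 * f 0 - f₂ 0| ≤ 2 * M := by
  have mem : ∀ t ∈ Set.Icc (0 : ℝ) 1, t ∈ Set.Icc (-1 : ℝ) 1 ∧ -t ∈ Set.Icc (-1 : ℝ) 1 :=
    fun t ht => ⟨⟨by linarith [ht.1], ht.2⟩, ⟨by linarith [ht.2], by linarith [ht.1]⟩⟩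
  have neg : ∀ {k k' : ℝ → ℝ}, (∀ t ∈ Set.Icc (-1 : ℝ) 1, HasDerivAt k (k' t) t) →
      ∀ t ∈ Set.Icc (0 : ℝ) 1, HasDerivAt (fun t => k (-t)) (-k' (-t)) t := by
    intro k k' hk t ht
    exact ((hk (-t) (mem t ht).2).comp t (hasDerivAt_neg t)).congr_deriv (by ring)
  have e₃ : ∀ t ∈ Set.Icc (0 : ℝ) 1, |f₃ t - f₃ (-t)| ≤ 2 * M := by
    refine abs_le_of_hasDerivAt_of_abs_le (g' := fun t => f₄ t - -f₄ (-t))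
      (fun t ht => (h₄ t (mem t ht).1).sub (neg h₄ t ht)) (by simp) fun t ht => ?_
    have a := abs_le.1 (hM t (mem t ht).1)
    have b := abs_le.1 (hM (-t) (mem t ht).2)
    exact abs_le.2 ⟨by linarith [a.1, b.1], by linarith [a.2, b.2]⟩
  have e₂ : ∀ t ∈ Set.Icc (0 : ℝ) 1, |f₂ t + f₂ (-t) - 2 * f₂ 0| ≤ 2 * M := by
    refine abs_le_of_hasDerivAt_of_abs_le (g' := fun t => f₃ t + -f₃ (-t))
      (fun t ht => ((h₃ t (mem t ht).1).add (neg h₃ t ht)).sub_const _) (by simp; ring)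
      fun t ht => ?_
    simpa [sub_eq_add_neg] using e₃ t ht
  have e₁ : ∀ t ∈ Set.Icc (0 : ℝ) 1, |f₁ t - f₁ (-t) - 2 * t * f₂ 0| ≤ 2 * M := by
    refine abs_le_of_hasDerivAt_of_abs_le (g' := fun t => f₂ t - -f₂ (-t) - 2 * f₂ 0)
      (fun t ht => ((h₂ t (mem t ht).1).sub (neg h₂ t ht)).sub ?_) (by simp) fun t ht => ?_
    · simpa using ((hasDerivAt_id t).const_mul 2).mul_const (f₂ 0)
    · simpa [sub_eq_add_neg] using e₂ t ht
  have e₀ : ∀ t ∈ Set.Icc (0 : ℝ) 1, |f t + f (-t) - 2 * f 0 - t ^ 2 * f₂ 0| ≤ 2 * M := by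
    refine abs_le_of_hasDerivAt_of_abs_le (g' := fun t => f₁ t + -f₁ (-t) - 2 * t * f₂ 0)
      (fun t ht => (((h₁ t (mem t ht).1).add (neg h₁ t ht)).sub_const _).sub ?_)
      (by simp; ring) fun t ht => ?_
    · simpa using ((hasDerivAt_id t).pow 2).mul_const (f₂ 0)
    · simpa [sub_eq_add_neg] using e₁ t ht
  simpa using e₀ 1 (by simp)

/-- The constant in the fourth order Taylor estimate for `q ^ p`, `q` quadratic. -/
def taylorConst (p : ℝ) : ℝ :=
  2 * ((16 * |p * (p - 1) * (p - 2) * (p - 3)| + 48 * |p * (p - 1) * (p - 2)| +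
    12 * |p * (p - 1)|) * (1 / 4) ^ (p - 2))

theorem taylorConst_nonneg (p : ℝ) : 0 ≤ taylorConst p := by
  unfold taylorConst; positivity

/-- The model is `q(t) = |z + te|²`. The condition `q'² ≤ 4Dq` (nonpositive discriminant) trades
every pair of factors `q'` for `Dq`, so each term of the fourth derivative is at most a multiple of
`D² q^{p-2}`; as `p - 2 < 0`, the lower bound `q ≥ A/4` finishes. -/
theorem abs_secondDiff_rpow_sub_le {A B D p : ℝ} (hA : 0 < A) (hp : p ≤ 0)
    (hq : ∀ t ∈ Set.Icc (-1 : ℝ) 1, A / 4 ≤ A + B * t + D * t ^ 2)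
    (hb : ∀ t ∈ Set.Icc (-1 : ℝ) 1, (B + 2 * D * t) ^ 2 ≤ 4 * D * (A + B * t + D * t ^ 2)) :
    |(A + B + D) ^ p + (A - B + D) ^ p - 2 * A ^ p -
        (p * (p - 1) * B ^ 2 * A ^ (p - 2) + 2 * p * D * A ^ (p - 1))| ≤
      taylorConst p * D ^ 2 * A ^ (p - 2) := by
  set q : ℝ → ℝ := fun t => A + B * t + D * t ^ 2 with hqdef
  set b : ℝ → ℝ := fun t => B + 2 * D * t with hbdef
  have hq' : ∀ t, HasDerivAt q (b t) t := by
    intro t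
    have := (((hasDerivAt_id t).const_mul B).const_add A).add
      (((hasDerivAt_id t).pow 2).const_mul D)
    exact this.congr_deriv (by simp [hbdef]; ring)
  have hb' : ∀ t, HasDerivAt b (2 * D) t := by
    intro t
    have := ((hasDerivAt_id t).const_mul (2 * D)).const_add B
    exact this.congr_deriv (by ring)
  have qpos : ∀ t ∈ Set.Icc (-1 : ℝ) 1, 0 < q t := fun t ht => by
    have := hq t ht
    simp only [hqdef]; linarith
  have pw : ∀ (r : ℝ), ∀ t ∈ Set.Icc (-1 : ℝ) 1,
      HasDerivAt (fun t => q t ^ r) (b t * r * q t ^ (r - 1)) t := fun r t ht =>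
    (hq' t).rpow_const (Or.inl (qpos t ht).ne')
  -- At `t = 0` the second condition reads `B² ≤ 4DA`, with `A > 0`.
  have hD : 0 ≤ D := by
    have h0 := hb 0 (by simp)
    simp only [mul_zero, add_zero, ne_eq, OfNat.ofNat_ne_zero, not_false_eq_true, zero_pow] at h0
    by_contra hneg
    push Not at hneg
    nlinarith [sq_nonneg B]
  have key := abs_secondDiff_sub_le
    (f := fun t => q t ^ p) (f₁ := fun t => p * b t * q t ^ (p - 1))
    (f₂ := fun t => p * (p - 1) * b t ^ 2 * q t ^ (p - 2) + p * (2 * D) * q t ^ (p - 1))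
    (f₃ := fun t => p * (p - 1) * (p - 2) * b t ^ 3 * q t ^ (p - 3)
      + 3 * p * (p - 1) * (2 * D) * b t * q t ^ (p - 2))
    (f₄ := fun t => p * (p - 1) * (p - 2) * (p - 3) * b t ^ 4 * q t ^ (p - 4)
      + 6 * p * (p - 1) * (p - 2) * (2 * D) * b t ^ 2 * q t ^ (p - 3)
      + 3 * p * (p - 1) * (2 * D) ^ 2 * q t ^ (p - 2))
    (M := (16 * |p * (p - 1) * (p - 2) * (p - 3)| + 48 * |p * (p - 1) * (p - 2)| +
        12 * |p * (p - 1)|) * D ^ 2 * (A / 4) ^ (p - 2))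
    (fun t ht => by convert pw p t ht using 1; ring)
    (fun t ht => by
      refine (((hb' t).const_mul p).mul (pw (p - 1) t ht)).congr_deriv ?_
      rw [show p - 1 - 1 = p - 2 by ring]; ring)
    (fun t ht => by
      refine (((((hb' t).pow 2).const_mul (p * (p - 1))).mul (pw (p - 2) t ht)).add
        ((pw (p - 1) t ht).const_mul (p * (2 * D)))).congr_deriv ?_
      rw [show p - 1 - 1 = p - 2 by ring, show p - 2 - 1 = p - 3 by ring]
      simp only [Pi.pow_apply]; push_cast; ring)
    (fun t ht => by
      refine (((((hb' t).pow 3).const_mul (p * (p - 1) * (p - 2))).mul (pw (p - 3) t ht)).add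
        (((hb' t).const_mul (3 * p * (p - 1) * (2 * D))).mul (pw (p - 2) t ht))).congr_deriv ?_
      rw [show p - 2 - 1 = p - 3 by ring, show p - 3 - 1 = p - 4 by ring]
      simp only [Pi.pow_apply]; push_cast; ring)
    (fun t ht => by
      have hpos := qpos t ht
      have hbq : b t ^ 2 ≤ 4 * D * q t := hb t ht
      set Q := q t ^ (p - 2) with hQ
      have hQ0 : 0 ≤ Q := (Real.rpow_pos_of_pos hpos _).le
      have e3 : q t * q t ^ (p - 3) = Q := by
        rw [hQ, show p - 2 = 1 + (p - 3) by ring, Real.rpow_add hpos, Real.rpow_one]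
      have e4 : q t ^ 2 * q t ^ (p - 4) = Q := by
        rw [hQ, show p - 2 = (2 : ℕ) + (p - 4) by push_cast; ring, Real.rpow_add hpos,
          Real.rpow_natCast]
      have n3 : 0 ≤ q t ^ (p - 3) := (Real.rpow_pos_of_pos hpos _).le
      have n4 : 0 ≤ q t ^ (p - 4) := (Real.rpow_pos_of_pos hpos _).le
      have b4 : b t ^ 4 * q t ^ (p - 4) ≤ 16 * D ^ 2 * Q := by
        have : b t ^ 4 ≤ (4 * D * q t) ^ 2 := by
          rw [show b t ^ 4 = (b t ^ 2) ^ 2 by ring]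
          exact pow_le_pow_left₀ (sq_nonneg _) hbq 2
        calc b t ^ 4 * q t ^ (p - 4) ≤ (4 * D * q t) ^ 2 * q t ^ (p - 4) := by gcongr
          _ = 16 * D ^ 2 * (q t ^ 2 * q t ^ (p - 4)) := by ring
          _ = _ := by rw [e4]
      have b3 : 2 * D * b t ^ 2 * q t ^ (p - 3) ≤ 8 * D ^ 2 * Q := by
        calc 2 * D * b t ^ 2 * q t ^ (p - 3) ≤ 2 * D * (4 * D * q t) * q t ^ (p - 3) := by gcongr
          _ = 8 * D ^ 2 * (q t * q t ^ (p - 3)) := by ring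
          _ = _ := by rw [e3]
      have hQle : Q ≤ (A / 4) ^ (p - 2) :=
        Real.rpow_le_rpow_of_nonpos (by positivity) (hq t ht) (by linarith)
      calc |p * (p - 1) * (p - 2) * (p - 3) * b t ^ 4 * q t ^ (p - 4)
            + 6 * p * (p - 1) * (p - 2) * (2 * D) * b t ^ 2 * q t ^ (p - 3)
            + 3 * p * (p - 1) * (2 * D) ^ 2 * Q|
          = |p * (p - 1) * (p - 2) * (p - 3) * (b t ^ 4 * q t ^ (p - 4))
            + p * (p - 1) * (p - 2) * (6 * (2 * D * b t ^ 2 * q t ^ (p - 3)))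
            + p * (p - 1) * (12 * D ^ 2 * Q)| := by congr 1; ring
        _ ≤ |p * (p - 1) * (p - 2) * (p - 3)| * (b t ^ 4 * q t ^ (p - 4))
            + |p * (p - 1) * (p - 2)| * (6 * (2 * D * b t ^ 2 * q t ^ (p - 3)))
            + |p * (p - 1)| * (12 * D ^ 2 * Q) := by
          refine (abs_add_three _ _ _).trans (le_of_eq ?_)
          rw [abs_mul _ (b t ^ 4 * _), abs_mul _ (6 * _), abs_mul _ (12 * _ * _),
            abs_of_nonneg (show 0 ≤ b t ^ 4 * q t ^ (p - 4) by positivity),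
            abs_of_nonneg (show 0 ≤ 6 * (2 * D * b t ^ 2 * q t ^ (p - 3)) by positivity),
            abs_of_nonneg (show 0 ≤ 12 * D ^ 2 * Q by positivity)]
        _ ≤ |p * (p - 1) * (p - 2) * (p - 3)| * (16 * D ^ 2 * Q)
            + |p * (p - 1) * (p - 2)| * (6 * (8 * D ^ 2 * Q))
            + |p * (p - 1)| * (12 * D ^ 2 * Q) := by gcongr
        _ = (16 * |p * (p - 1) * (p - 2) * (p - 3)| + 48 * |p * (p - 1) * (p - 2)| +
              12 * |p * (p - 1)|) * D ^ 2 * Q := by ring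
        _ ≤ _ := by gcongr)
  have e : (A / 4) ^ (p - 2) = (1 / 4) ^ (p - 2) * A ^ (p - 2) := by
    rw [← Real.mul_rpow (by norm_num) hA.le]; congr 1; ring
  rw [e] at key
  simp only [hqdef, hbdef] at key
  convert key using 1
  · congr 1
    norm_num
    ring_nf
  · unfold taylorConst; ring

/-! ### Second differences of the Riesz kernel -/

/-- The symmetric second difference `v(z + e) + v(z - e) - 2 v(z)`. -/
def secDiff (v : Plane → ℝ) (e z : Plane) : ℝ := v (z + e) + v (z - e) - 2 * v z

/-- The Riesz kernel `|z|^{-2s}`. -/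
def kernel (s : ℝ) (z : Plane) : ℝ := ‖z‖ ^ (-2 * s)

/-- Since `|e| ≤ |z|/2`, the segment from `z - e` to `z + e` stays at distance at least `|z|/2` from
the singularity; the discriminant condition is Cauchy–Schwarz for `z + te` and `e`. -/
theorem abs_secDiff_kernel_sub_le {s : ℝ} (hs : 0 ≤ s) {e z : Plane} (hz : z ≠ 0)
    (hez : 2 * ‖e‖ ≤ ‖z‖) :
    |secDiff (kernel s) e z - (4 * s * (s + 1) * inner ℝ z e ^ 2 * ‖z‖ ^ (-2 * s - 4) -
        2 * s * ‖e‖ ^ 2 * ‖z‖ ^ (-2 * s - 2))| ≤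
      taylorConst (-s) * ‖e‖ ^ 4 * ‖z‖ ^ (-2 * s - 4) := by
  have hz0 : 0 < ‖z‖ := norm_pos_iff.2 hz
  have nrm : ∀ t : ℝ, ‖z‖ ^ 2 + 2 * inner ℝ z e * t + ‖e‖ ^ 2 * t ^ 2 = ‖z + t • e‖ ^ 2 := by
    intro t
    rw [norm_add_sq_real, inner_smul_right, norm_smul, mul_pow, Real.norm_eq_abs, sq_abs]; ring
  have key := abs_secondDiff_rpow_sub_le (A := ‖z‖ ^ 2) (B := 2 * inner ℝ z e) (D := ‖e‖ ^ 2)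
    (p := -s) (by positivity) (by linarith)
    (fun t ht => by
      rw [nrm]
      have h1 : ‖z‖ - ‖t • e‖ ≤ ‖z + t • e‖ := by
        have := norm_sub_norm_le z (-(t • e)); simpa using this
      have h2 : ‖t • e‖ ≤ ‖e‖ := by
        rw [norm_smul, Real.norm_eq_abs]
        exact mul_le_of_le_one_left (norm_nonneg _) (abs_le.2 ht)
      have h3 : ‖z‖ / 2 ≤ ‖z + t • e‖ := by linarith
      nlinarith)
    (fun t ht => by
      rw [nrm]
      have h : 2 * inner ℝ z e + 2 * ‖e‖ ^ 2 * t = 2 * inner ℝ (z + t • e) e := by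
        rw [inner_add_left, inner_smul_left, real_inner_self_eq_norm_sq]; simp; ring
      rw [h]
      have := abs_real_inner_le_norm (z + t • e) e
      have h2 : (inner ℝ (z + t • e) e : ℝ) ^ 2 ≤ (‖z + t • e‖ * ‖e‖) ^ 2 :=
        sq_le_sq' (by linarith [neg_abs_le (inner ℝ (z + t • e) e : ℝ)])
          ((le_abs_self _).trans this)
      nlinarith)
  have p1 : ‖z‖ ^ 2 + 2 * inner ℝ z e + ‖e‖ ^ 2 = ‖z + e‖ ^ 2 := by
    simpa using nrm 1
  have p2 : ‖z‖ ^ 2 - 2 * inner ℝ z e + ‖e‖ ^ 2 = ‖z - e‖ ^ 2 := by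
    rw [norm_sub_sq_real]
  have pw : ∀ (w : Plane) (r : ℝ), (‖w‖ ^ 2) ^ r = ‖w‖ ^ (2 * r) := fun w r => by
    rw [Real.rpow_mul (norm_nonneg _)]; norm_num
  rw [p1, p2] at key
  simp only [pw] at key
  unfold secDiff kernel
  rw [show 2 * -s = -2 * s by ring, show 2 * (-s - 2) = -2 * s - 4 by ring,
    show 2 * (-s - 1) = -2 * s - 2 by ring] at key
  convert key using 2 <;> ring

/-- Cruder than the expansion, but this decay is what makes the differenced kernel integrable at
infinity. -/
theorem abs_secDiff_kernel_le {s : ℝ} (hs : 0 ≤ s) {e z : Plane} (hz : z ≠ 0)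
    (hez : 2 * ‖e‖ ≤ ‖z‖) :
    |secDiff (kernel s) e z| ≤
      (taylorConst (-s) + 4 * s * (s + 1) + 2 * s) * ‖e‖ ^ 2 * ‖z‖ ^ (-2 * s - 2) := by
  have hz0 : 0 < ‖z‖ := norm_pos_iff.2 hz
  have key := abs_secDiff_kernel_sub_le hs hz hez
  have e4 : ‖z‖ ^ (-2 * s - 2) = ‖z‖ ^ 2 * ‖z‖ ^ (-2 * s - 4) := by
    rw [show -2 * s - 2 = (2 : ℕ) + (-2 * s - 4) by push_cast; ring, Real.rpow_add hz0,
      Real.rpow_natCast]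
  rw [e4] at key ⊢
  set P := ‖z‖ ^ (-2 * s - 4)
  have hP : 0 ≤ P := Real.rpow_nonneg (norm_nonneg _) _
  have hin : (inner ℝ z e : ℝ) ^ 2 ≤ (‖z‖ * ‖e‖) ^ 2 := by
    have := abs_real_inner_le_norm z e
    exact sq_le_sq' (by linarith [neg_abs_le (inner ℝ z e : ℝ)]) ((le_abs_self _).trans this)
  have hT := taylorConst_nonneg (-s)
  have h1 : taylorConst (-s) * ‖e‖ ^ 4 * P ≤ taylorConst (-s) * ‖e‖ ^ 2 * (‖z‖ ^ 2 * P) := by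
    have : ‖e‖ ^ 2 ≤ ‖z‖ ^ 2 := by
      apply pow_le_pow_left₀ (norm_nonneg _); linarith [norm_nonneg e]
    calc taylorConst (-s) * ‖e‖ ^ 4 * P = taylorConst (-s) * ‖e‖ ^ 2 * (‖e‖ ^ 2 * P) := by ring
      _ ≤ _ := by gcongr
  have h2 : 4 * s * (s + 1) * inner ℝ z e ^ 2 * P ≤ 4 * s * (s + 1) * ‖e‖ ^ 2 * (‖z‖ ^ 2 * P) := by
    calc 4 * s * (s + 1) * inner ℝ z e ^ 2 * P ≤ 4 * s * (s + 1) * (‖z‖ * ‖e‖) ^ 2 * P := by gcongr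
      _ = _ := by ring
  have h3 : 0 ≤ 4 * s * (s + 1) * inner ℝ z e ^ 2 * P := by positivity
  have h4 : 0 ≤ 2 * s * ‖e‖ ^ 2 * (‖z‖ ^ 2 * P) := by positivity
  have h5 : 0 ≤ 4 * s * (s + 1) * ‖e‖ ^ 2 * (‖z‖ ^ 2 * P) := by positivity
  rw [abs_le] at key ⊢
  constructor <;> nlinarith [key.1, key.2]

/-- Rotation by a right angle. -/
def rot (a : Plane) : Plane := !₂[-a 1, a 0]

theorem norm_sq_eq (a : Plane) : ‖a‖ ^ 2 = a 0 ^ 2 + a 1 ^ 2 := by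
  rw [EuclideanSpace.norm_sq_eq]; simp

theorem norm_rot (a : Plane) : ‖rot a‖ = ‖a‖ := by
  have : ‖rot a‖ ^ 2 = ‖a‖ ^ 2 := by
    rw [norm_sq_eq, norm_sq_eq]; simp [rot]; ring
  exact (pow_left_inj₀ (norm_nonneg _) (norm_nonneg _) two_ne_zero).1 this

theorem rot_smul (h : ℝ) (a : Plane) : rot (h • a) = h • rot a := by
  ext i; fin_cases i <;> simp [rot]

/-- Pythagoras in the frame `a`, `rot a`: two second differences along it see the full Laplacian,
whatever the direction of `a`. -/
theorem inner_sq_add_inner_rot_sq (z a : Plane) :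
    inner ℝ z a ^ 2 + inner ℝ z (rot a) ^ 2 = ‖z‖ ^ 2 * ‖a‖ ^ 2 := by
  rw [norm_sq_eq, norm_sq_eq]
  simp [rot, PiLp.inner_apply, Fin.sum_univ_two]; ring

/-- The difference between `4 s² |z|^{-2s-2}`, the Laplacian of the kernel, and its discretization
along the orthogonal directions `a`, `rot a`. -/
def truncErr (s : ℝ) (a z : Plane) : ℝ :=
  4 * s ^ 2 * ‖z‖ ^ (-2 * s - 2) -
    (secDiff (kernel s) a z + secDiff (kernel s) (rot a) z) / ‖a‖ ^ 2

/-- The second-order terms along `a` and `rot a` add up to `(4s(s+1) - 4s)|a|²|z|^{-2s-2}`, which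
cancels `4s²|z|^{-2s-2}` after division by `|a|²`; only the two Taylor remainders survive. -/
theorem abs_truncErr_le {s : ℝ} (hs : 0 ≤ s) {a z : Plane} (hz : z ≠ 0)
    (ha : a ≠ 0) (haz : 2 * ‖a‖ ≤ ‖z‖) :
    |truncErr s a z| ≤ 2 * taylorConst (-s) * ‖a‖ ^ 2 * ‖z‖ ^ (-2 * s - 4) := by
  have hz0 : 0 < ‖z‖ := norm_pos_iff.2 hz
  have ha0 : 0 < ‖a‖ := norm_pos_iff.2 ha
  have e4 : ‖z‖ ^ (-2 * s - 2) = ‖z‖ ^ 2 * ‖z‖ ^ (-2 * s - 4) := by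
    rw [show -2 * s - 2 = (2 : ℕ) + (-2 * s - 4) by push_cast; ring, Real.rpow_add hz0,
      Real.rpow_natCast]
  have k1 := abs_secDiff_kernel_sub_le hs hz haz
  have k2 := abs_secDiff_kernel_sub_le (e := rot a) hs hz (by rwa [norm_rot])
  rw [norm_rot] at k2
  have hin := inner_sq_add_inner_rot_sq z a
  unfold truncErr
  rw [e4] at *
  set P := ‖z‖ ^ (-2 * s - 4)
  set D1 := secDiff (kernel s) a z
  set D2 := secDiff (kernel s) (rot a) z
  have e : 4 * s ^ 2 * (‖z‖ ^ 2 * P) - (D1 + D2) / ‖a‖ ^ 2 =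
      -((D1 - (4 * s * (s + 1) * inner ℝ z a ^ 2 * P - 2 * s * ‖a‖ ^ 2 * (‖z‖ ^ 2 * P))) +
        (D2 - (4 * s * (s + 1) * inner ℝ z (rot a) ^ 2 * P -
          2 * s * ‖a‖ ^ 2 * (‖z‖ ^ 2 * P)))) / ‖a‖ ^ 2 := by
    field_simp
    linear_combination (-4 * s * (s + 1) * P) * hin
  rw [e, abs_div, abs_neg, abs_of_pos (show 0 < ‖a‖ ^ 2 by positivity), div_le_iff₀ (by positivity)]
  refine (abs_add_le _ _).trans ((add_le_add k1 k2).trans (le_of_eq ?_))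
  ring

/-! ### Integrability of powers of the norm -/

/-- Polar coordinates: the plane contributes the Jacobian `r`, hence the exponent `p + 1`. -/
theorem integrableOn_norm_rpow {p : ℝ} {A : Set ℝ} (hA : MeasurableSet A)
    (h : IntegrableOn (fun r : ℝ => r ^ (p + 1)) (Set.Ioi 0 ∩ A)) :
    IntegrableOn (fun z : Plane => ‖z‖ ^ p) {z | ‖z‖ ∈ A} := by
  have hm : MeasurableSet {z : Plane | ‖z‖ ∈ A} := measurable_norm hA
  rw [← integrable_indicator_iff hm]
  have : (Set.indicator {z : Plane | ‖z‖ ∈ A} fun z => ‖z‖ ^ p) =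
      fun z => (A.indicator fun r => r ^ p) ‖z‖ := by
    ext z
    by_cases hz : ‖z‖ ∈ A
    · rw [Set.indicator_of_mem hz, Set.indicator_of_mem (show z ∈ {z : Plane | ‖z‖ ∈ A} from hz)]
    · rw [Set.indicator_of_notMem hz,
        Set.indicator_of_notMem (show z ∉ {z : Plane | ‖z‖ ∈ A} from hz)]
  rw [this, integrable_fun_norm_addHaar]
  have e : Set.EqOn (fun y : ℝ => y ^ (Module.finrank ℝ Plane - 1) • A.indicator (fun r => r ^ p) y)
      (A.indicator fun r => r ^ (p + 1)) (Set.Ioi 0) := by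
    intro y hy
    by_cases hyA : y ∈ A
    · simp only [finrank_euclideanSpace, Fintype.card_fin, smul_eq_mul, Set.indicator_of_mem hyA]
      rw [Real.rpow_add hy, Real.rpow_one, mul_comm]; simp
    · simp [hyA]
  rw [integrableOn_congr_fun e measurableSet_Ioi]
  rw [IntegrableOn, integrable_indicator_iff hA, IntegrableOn, Measure.restrict_restrict hA,
    Set.inter_comm]
  exact h

theorem integrableOn_norm_rpow_le {p : ℝ} (hp : -2 < p) (R : ℝ) :
    IntegrableOn (fun z : Plane => ‖z‖ ^ p) {z | ‖z‖ ≤ R} := by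
  refine integrableOn_norm_rpow (A := Set.Iic R) measurableSet_Iic ?_
  rw [Set.Ioi_inter_Iic]
  rcases le_or_gt R 0 with h | h
  · rw [Set.Ioc_eq_empty (by simpa using h)]; simp
  · exact (intervalIntegrable_iff_integrableOn_Ioc_of_le h.le).1
      (intervalIntegral.intervalIntegrable_rpow' (by linarith))

theorem integrableOn_norm_rpow_gt {p R : ℝ} (hp : p < -2) (hR : 0 < R) :
    IntegrableOn (fun z : Plane => ‖z‖ ^ p) {z | R < ‖z‖} := by
  refine integrableOn_norm_rpow (A := Set.Ioi R) measurableSet_Ioi ?_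
  rw [Set.Ioi_inter_Ioi, sup_of_le_right hR.le]
  exact integrableOn_Ioi_rpow_of_lt (by linarith) hR

/-! ### Integrability, scaling and mean value of the differenced kernel -/

theorem measurable_kernel (s : ℝ) : Measurable (kernel s) := by
  unfold kernel; fun_prop

theorem measurable_secDiff_kernel (s : ℝ) (e : Plane) : Measurable (secDiff (kernel s) e) := by
  have := measurable_kernel s
  unfold secDiff; fun_prop

theorem measurable_truncErr (s : ℝ) (a : Plane) : Measurable (truncErr s a) := by
  have := measurable_secDiff_kernel s
  unfold truncErr; fun_prop

/-- The kernel is locally integrable. -/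
theorem integrableOn_kernel_add {s : ℝ} (hs : s < 1) (e : Plane) (R : ℝ) :
    IntegrableOn (fun z => kernel s (z + e)) {z | ‖z‖ ≤ R} := by
  have h : IntegrableOn (fun z : Plane => ‖z‖ ^ (-2 * s)) {z | ‖z‖ ≤ R + ‖e‖} :=
    integrableOn_norm_rpow_le (by linarith) _
  have hm : ∀ r : ℝ, MeasurableSet {z : Plane | ‖z‖ ≤ r} := fun r =>
    measurableSet_le measurable_norm measurable_const
  rw [← integrable_indicator_iff (hm _)] at h ⊢
  refine (h.comp_add_right e).mono
    (((measurable_kernel s).comp (measurable_id.add_const e)).aestronglyMeasurable.indicator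
      (hm _)) (ae_of_all _ fun z => ?_)
  by_cases hz : ‖z‖ ≤ R
  · have h2 : ‖z + e‖ ≤ R + ‖e‖ := (norm_add_le _ _).trans (by linarith)
    simp [Set.indicator, hz, h2, kernel]
  · simp [Set.indicator, hz]

theorem integrableOn_secDiff_kernel {s : ℝ} (hs : s < 1) (e : Plane) (R : ℝ) :
    IntegrableOn (secDiff (kernel s) e) {z | ‖z‖ ≤ R} := by
  have h1 := integrableOn_kernel_add hs e R
  have h2 := integrableOn_kernel_add hs (-e) R
  have h3 := integrableOn_kernel_add hs 0 R
  simp only [add_zero, ← sub_eq_add_neg] at h2 h3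
  exact (h1.add h2).sub (h3.const_mul 2)

theorem integrable_of_le_of_gt {f : Plane → ℝ} {R : ℝ} (h1 : IntegrableOn f {z | ‖z‖ ≤ R})
    (h2 : IntegrableOn f {z | R < ‖z‖}) : Integrable f := by
  rw [← integrableOn_univ]
  have : (Set.univ : Set Plane) = {z | ‖z‖ ≤ R} ∪ {z | R < ‖z‖} := by
    ext z; simp [le_or_gt]
  rw [this]; exact h1.union h2

theorem measurableSet_norm_gt (R : ℝ) : MeasurableSet {z : Plane | R < ‖z‖} :=
  measurableSet_lt measurable_const measurable_norm

theorem measurableSet_norm_le (R : ℝ) : MeasurableSet {z : Plane | ‖z‖ ≤ R} :=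
  measurableSet_le measurable_norm measurable_const

/-- The singularities `|z|^{-2s}` are locally integrable because `s < 1`, and the decay
`|z|^{-2s-2}` is integrable at infinity because `s > 0`. -/
theorem integrable_secDiff_kernel {s : ℝ} (hs : 0 < s) (hs1 : s < 1) (e : Plane) :
    Integrable (secDiff (kernel s) e) := by
  refine integrable_of_le_of_gt (integrableOn_secDiff_kernel hs1 e (2 * ‖e‖ + 1)) ?_
  have hR : 0 < 2 * ‖e‖ + 1 := by positivity
  refine ((integrableOn_norm_rpow_gt (p := -2 * s - 2) (by linarith) hR).const_mul
    ((taylorConst (-s) + 4 * s * (s + 1) + 2 * s) * ‖e‖ ^ 2)).mono'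
    (measurable_secDiff_kernel s e).aestronglyMeasurable ?_
  refine (ae_restrict_iff' (measurableSet_norm_gt _)).2 (ae_of_all _ fun z hz => ?_)
  have hz : 2 * ‖e‖ + 1 < ‖z‖ := hz
  exact abs_secDiff_kernel_le hs.le (norm_pos_iff.1 (hR.trans hz)) (by linarith)

theorem secDiff_kernel_smul {s h : ℝ} (hh : 0 < h) (e z : Plane) :
    secDiff (kernel s) (h • e) (h • z) = h ^ (-2 * s) * secDiff (kernel s) e z := by
  have k : ∀ w : Plane, kernel s (h • w) = h ^ (-2 * s) * kernel s w := fun w => by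
    rw [kernel, norm_smul, Real.norm_of_nonneg hh.le, Real.mul_rpow hh.le (norm_nonneg _), kernel]
  simp only [secDiff, ← smul_add, ← smul_sub, k]; ring

theorem integral_eq_sq_mul_integral_smul {h : ℝ} (hh : 0 < h) (F : Plane → ℝ) :
    ∫ z, F z = h ^ 2 * ∫ z, F (h • z) := by
  rw [Measure.integral_comp_smul_of_nonneg volume F h (hR := hh.le)]
  simp only [finrank_euclideanSpace, Fintype.card_fin, smul_eq_mul]
  field_simp

theorem integral_secDiff_kernel_smul {s h : ℝ} (hh : 0 < h) (e : Plane) :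
    ∫ z, secDiff (kernel s) (h • e) z = h ^ (2 - 2 * s) * ∫ z, secDiff (kernel s) e z := by
  rw [integral_eq_sq_mul_integral_smul hh]
  simp only [secDiff_kernel_smul hh, integral_const_mul]
  rw [show (2 - 2 * s : ℝ) = (2 : ℕ) + (-2 * s) by push_cast; ring, Real.rpow_add hh,
    Real.rpow_natCast]; ring

theorem integral_abs_secDiff_kernel_smul {s h : ℝ} (hh : 0 < h) (e : Plane) :
    ∫ z, |secDiff (kernel s) (h • e) z| =
      h ^ (2 - 2 * s) * ∫ z, |secDiff (kernel s) e z| := by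
  rw [integral_eq_sq_mul_integral_smul hh]
  simp only [secDiff_kernel_smul hh, abs_mul, abs_of_pos (Real.rpow_pos_of_pos hh _),
    integral_const_mul]
  rw [show (2 - 2 * s : ℝ) = (2 : ℕ) + (-2 * s) by push_cast; ring, Real.rpow_add hh,
    Real.rpow_natCast]; ring

/-- The kernel itself is not integrable, so translation invariance cannot be applied term by term.
Instead, doubling the step multiplies the integral by `4` through translations and by `2^{2-2s} < 4`
through scaling, so it vanishes. -/
theorem integral_secDiff_kernel {s : ℝ} (hs : 0 < s) (hs1 : s < 1) (e : Plane) :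
    ∫ z, secDiff (kernel s) e z = 0 := by
  have hi := integrable_secDiff_kernel hs hs1 e
  have h2 : ∫ z, secDiff (kernel s) ((2 : ℝ) • e) z = 4 * ∫ z, secDiff (kernel s) e z := by
    -- A second difference of step `2e` is a combination of translates of those of step `e`, with
    -- weights `1, 2, 1`.
    have : secDiff (kernel s) ((2 : ℝ) • e) = fun z => secDiff (kernel s) e (z + e) +
        secDiff (kernel s) e (z - e) + 2 * secDiff (kernel s) e z := by
      ext z
      simp only [secDiff, two_smul, add_sub_cancel_right, sub_add_cancel, ← add_assoc, ← sub_sub]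
      ring
    have hadd : Integrable fun z => secDiff (kernel s) e (z + e) + secDiff (kernel s) e (z - e) :=
      (hi.comp_add_right e).add (hi.comp_sub_right e)
    simp only [this]
    rw [integral_add hadd (hi.const_mul 2),
      integral_add (hi.comp_add_right e) (hi.comp_sub_right e), integral_const_mul,
      integral_add_right_eq_self (secDiff (kernel s) e), integral_sub_right_eq_self (secDiff (kernel s) e)]
    ring
  rw [integral_secDiff_kernel_smul two_pos] at h2
  have h3 : (2 : ℝ) ^ (2 - 2 * s) < 4 := by
    calc (2 : ℝ) ^ (2 - 2 * s) < 2 ^ (2 : ℝ) :=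
          Real.rpow_lt_rpow_of_exponent_lt one_lt_two (by linarith)
      _ = 4 := by norm_num
  have h4 : ((2 : ℝ) ^ (2 - 2 * s) - 4) * ∫ z, secDiff (kernel s) e z = 0 := by linarith
  exact (mul_eq_zero.1 h4).resolve_left (by linarith)

/-- Near the origin the worst term is `|z|^{-2s-2+1+α}`, integrable because `α > 2s - 1`. At
infinity the product decays like `|z|^{-2s-4+1+α}`, integrable because `α ≤ 1` and `s > 0`. -/
theorem integrable_truncErr_mul {s α : ℝ} (hs : 0 < s) (hs1 : s < 1) (hα : 2 * s - 1 < α)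
    (hα1 : α ≤ 1) {a : Plane} (ha : a ≠ 0) :
    Integrable fun z => |truncErr s a z| * ‖z‖ ^ (1 + α) := by
  have ha0 : 0 < ‖a‖ := norm_pos_iff.2 ha
  have hmeas : AEStronglyMeasurable (fun z => |truncErr s a z| * ‖z‖ ^ (1 + α)) := by
    have := measurable_truncErr s a
    have : Measurable (fun z => |truncErr s a z| * ‖z‖ ^ (1 + α)) :=
      (continuous_abs.measurable.comp this).mul (by fun_prop)
    exact this.aestronglyMeasurable
  refine integrable_of_le_of_gt (R := 2 * ‖a‖) ?_ ?_
  · have h1 : IntegrableOn (fun z : Plane => ‖z‖ ^ (-2 * s - 2 + (1 + α))) {z | ‖z‖ ≤ 2 * ‖a‖} :=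
      integrableOn_norm_rpow_le (by linarith) _
    have h2 := integrableOn_secDiff_kernel hs1 a (2 * ‖a‖)
    have h3 := integrableOn_secDiff_kernel hs1 (rot a) (2 * ‖a‖)
    refine ((h1.const_mul (4 * s ^ 2)).add
      ((h2.abs.add h3.abs).const_mul ((2 * ‖a‖) ^ (1 + α) / ‖a‖ ^ 2))).mono' hmeas.restrict ?_
    refine (ae_restrict_iff' (measurableSet_norm_le _)).2 ?_
    refine (Measure.ae_ne volume (0 : Plane)).mono fun z hz0 hz => ?_
    have hz : ‖z‖ ≤ 2 * ‖a‖ := hz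
    have hzp : 0 < ‖z‖ := norm_pos_iff.2 hz0
    rw [Real.norm_eq_abs, abs_mul, abs_abs, abs_of_pos (Real.rpow_pos_of_pos hzp _)]
    simp only [Pi.add_apply]
    rw [Real.rpow_add hzp (-2 * s - 2) (1 + α)]
    have hle : ‖z‖ ^ (1 + α) ≤ (2 * ‖a‖) ^ (1 + α) :=
      Real.rpow_le_rpow hzp.le hz (by linarith)
    have hT : |truncErr s a z| ≤ 4 * s ^ 2 * ‖z‖ ^ (-2 * s - 2) +
        (|secDiff (kernel s) a z| + |secDiff (kernel s) (rot a) z|) / ‖a‖ ^ 2 := by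
      refine (abs_sub _ _).trans ?_
      rw [abs_div, abs_of_pos (show 0 < ‖a‖ ^ 2 by positivity), abs_of_nonneg (by positivity)]
      gcongr
      exact abs_add_le _ _
    calc |truncErr s a z| * ‖z‖ ^ (1 + α)
        ≤ (4 * s ^ 2 * ‖z‖ ^ (-2 * s - 2) +
          (|secDiff (kernel s) a z| + |secDiff (kernel s) (rot a) z|) / ‖a‖ ^ 2) *
            ‖z‖ ^ (1 + α) := by gcongr
      _ = 4 * s ^ 2 * (‖z‖ ^ (-2 * s - 2) * ‖z‖ ^ (1 + α)) +
          (|secDiff (kernel s) a z| + |secDiff (kernel s) (rot a) z|) / ‖a‖ ^ 2 *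
            ‖z‖ ^ (1 + α) := by ring
      _ ≤ 4 * s ^ 2 * (‖z‖ ^ (-2 * s - 2) * ‖z‖ ^ (1 + α)) +
          (|secDiff (kernel s) a z| + |secDiff (kernel s) (rot a) z|) / ‖a‖ ^ 2 *
            (2 * ‖a‖) ^ (1 + α) := by gcongr
      _ = _ := by ring
  · refine ((integrableOn_norm_rpow_gt (p := -2 * s - 4 + (1 + α)) (by linarith)
      (show 0 < 2 * ‖a‖ by positivity)).const_mul
      (2 * taylorConst (-s) * ‖a‖ ^ 2)).mono' hmeas.restrict ?_
    refine (ae_restrict_iff' (measurableSet_norm_gt _)).2 (ae_of_all _ fun z hz => ?_)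
    have hz : 2 * ‖a‖ < ‖z‖ := hz
    have hzp : 0 < ‖z‖ := by linarith
    rw [Real.norm_eq_abs, abs_mul, abs_abs, abs_of_pos (Real.rpow_pos_of_pos hzp _),
      Real.rpow_add hzp (-2 * s - 4) (1 + α), ← mul_assoc]
    refine mul_le_mul_of_nonneg_right ?_ (Real.rpow_pos_of_pos hzp _).le
    exact abs_truncErr_le hs.le (norm_pos_iff.1 hzp) ha hz.le

theorem truncErr_smul {s h : ℝ} (hh : 0 < h) (a z : Plane) :
    truncErr s (h • a) (h • z) = h ^ (-2 * s - 2) * truncErr s a z := by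
  unfold truncErr
  rw [rot_smul, secDiff_kernel_smul hh, secDiff_kernel_smul hh, norm_smul, norm_smul,
    Real.norm_of_nonneg hh.le, Real.mul_rpow hh.le (norm_nonneg _)]
  have : h ^ (-2 * s) = h ^ (-2 * s - 2) * h ^ 2 := by
    rw [← Real.rpow_natCast h 2, ← Real.rpow_add hh]; norm_num
  rw [this]
  rcases eq_or_ne a 0 with rfl | ha
  · simp; ring
  · have := norm_ne_zero_iff.2 ha
    field_simp

/-- Source of the convergence rate: homogeneity `-2s-2` of the truncation error, weight `1+α` and
Jacobian `2` add up to `1+α-2s`. -/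
theorem integral_truncErr_mul_smul {s α h : ℝ} (hh : 0 < h) (a : Plane) :
    ∫ z, |truncErr s (h • a) z| * ‖z‖ ^ (1 + α) =
      h ^ (1 + α - 2 * s) * ∫ z, |truncErr s a z| * ‖z‖ ^ (1 + α) := by
  rw [integral_eq_sq_mul_integral_smul hh]
  simp only [truncErr_smul hh, norm_smul, Real.norm_of_nonneg hh.le,
    Real.mul_rpow hh.le (norm_nonneg _), abs_mul, abs_of_pos (Real.rpow_pos_of_pos hh _)]
  rw [← integral_const_mul, ← integral_const_mul]
  congr 1; ext z
  rw [show (1 + α - 2 * s : ℝ) = (2 : ℕ) + (-2 * s - 2) + (1 + α) by push_cast; ring,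
    Real.rpow_add hh _ (1 + α), Real.rpow_add hh _ (-2 * s - 2), Real.rpow_natCast]; ring

/-! ### Convolution of even kernels with bounded functions -/

theorem ae_comp_add {P : Plane → Prop} (h : ∀ᵐ y, P y) (x : Plane) : ∀ᵐ z, P (x + z) :=
  (quasiMeasurePreserving_add_left volume x).ae h

theorem ae_comp_sub {P : Plane → Prop} (h : ∀ᵐ y, P y) (x : Plane) : ∀ᵐ z, P (x - z) :=
  (quasiMeasurePreserving_sub_left volume x).ae h

theorem aesm_comp_add {v : Plane → ℝ} (h : AEStronglyMeasurable v) (x : Plane) :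
    AEStronglyMeasurable fun z => v (x + z) :=
  h.comp_quasiMeasurePreserving (quasiMeasurePreserving_add_left volume x)

theorem aesm_comp_sub {v : Plane → ℝ} (h : AEStronglyMeasurable v) (x : Plane) :
    AEStronglyMeasurable fun z => v (x - z) :=
  h.comp_quasiMeasurePreserving (quasiMeasurePreserving_sub_left volume x)

theorem aesm_secDiff {v : Plane → ℝ} (h : AEStronglyMeasurable v) (x : Plane) :
    AEStronglyMeasurable fun z => secDiff v z x :=
  ((aesm_comp_add h x).add (aesm_comp_sub h x)).sub aestronglyMeasurable_const

theorem abs_secDiff_le_of_ae {v : Plane → ℝ} {M : ℝ} (hM : ∀ᵐ y, |v y| ≤ M) {x : Plane}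
    (hx : |v x| ≤ M) : ∀ᵐ z, |secDiff v z x| ≤ 4 * M := by
  filter_upwards [ae_comp_add hM x, ae_comp_sub hM x] with z h1 h2
  rw [abs_le] at *
  unfold secDiff
  constructor <;> linarith [h1.1, h1.2, h2.1, h2.2, hx.1, hx.2]

theorem integrable_comp_sub_mul {G v : Plane → ℝ} {M : ℝ} (hG : Integrable G)
    (hv : AEStronglyMeasurable v) (hM : ∀ᵐ y, |v y| ≤ M) (x : Plane) :
    Integrable fun y => G (x - y) * v y :=
  (hG.comp_sub_left x).mul_bdd hv hM

/-- Average of the substitutions `y = x - z` and `y = x + z`, which give the same kernel by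
evenness. -/
theorem integral_comp_sub_mul {G v : Plane → ℝ} {M : ℝ} (hG : Integrable G)
    (heven : ∀ z, G (-z) = G z)
    (hv : AEStronglyMeasurable v) (hM : ∀ᵐ y, |v y| ≤ M) (x : Plane) :
    ∫ y, G (x - y) * v y = (1 / 2) * (∫ z, G z * secDiff v z x) + v x * ∫ z, G z := by
  have i1 : ∫ y, G (x - y) * v y = ∫ z, G z * v (x - z) := by
    rw [← integral_sub_left_eq_self (fun y => G (x - y) * v y) volume x]
    simp only [sub_sub_cancel]
  have i2 : ∫ y, G (x - y) * v y = ∫ z, G z * v (x + z) := by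
    rw [← integral_add_left_eq_self (fun y => G (x - y) * v y) x]
    simp only [sub_add_cancel_left, heven]
  have I1 : Integrable fun z => G z * v (x - z) := hG.mul_bdd (aesm_comp_sub hv x) (ae_comp_sub hM x)
  have I2 : Integrable fun z => G z * v (x + z) := hG.mul_bdd (aesm_comp_add hv x) (ae_comp_add hM x)
  have e : ∀ z, G z * secDiff v z x = G z * v (x + z) + G z * v (x - z) - 2 * v x * G z := fun z => by
    unfold secDiff; ring
  have I3 : Integrable fun z => G z * v (x + z) + G z * v (x - z) := I2.add I1
  simp only [e]
  rw [integral_sub I3 (hG.const_mul _), integral_add I2 I1, integral_const_mul, ← i1, ← i2]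
  ring

/-! ### Riesz potentials -/

/-- The (unnormalised) Riesz potential of `v`. -/
def pot (s : ℝ) (v : Plane → ℝ) (x : Plane) : ℝ := ∫ y, kernel s (x - y) * v y

theorem integrable_kernel_mul {s M : ℝ} (hs1 : s < 1) {v : Plane → ℝ}
    (hv : AEStronglyMeasurable v) (hM : ∀ᵐ y, |v y| ≤ M)
    (hsupp : Bornology.IsBounded (Function.support v)) (x : Plane) :
    Integrable fun y => kernel s (x - y) * v y := by
  obtain ⟨R, hR⟩ := hsupp.subset_closedBall 0
  have h := integrableOn_kernel_add hs1 (-x) R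
  rw [← integrable_indicator_iff (measurableSet_norm_le R)] at h
  refine (h.mul_bdd hv hM).congr (ae_of_all _ fun y => ?_)
  by_cases hy : v y = 0
  · simp [hy]
  · have : y ∈ {z : Plane | ‖z‖ ≤ R} := by simpa using hR hy
    simp only [Set.indicator_of_mem this, kernel, ← sub_eq_add_neg, norm_sub_rev]

theorem secDiff_kernel_neg (s : ℝ) (e z : Plane) :
    secDiff (kernel s) e (-z) = secDiff (kernel s) e z := by
  unfold secDiff kernel
  rw [show -z + e = -(z - e) by abel, show -z - e = -(z + e) by abel, norm_neg, norm_neg, norm_neg]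
  ring

theorem secDiff_pot {s M : ℝ} (hs1 : s < 1) {v : Plane → ℝ}
    (hv : AEStronglyMeasurable v) (hM : ∀ᵐ y, |v y| ≤ M)
    (hsupp : Bornology.IsBounded (Function.support v)) (e x : Plane) :
    secDiff (pot s v) e x = ∫ y, secDiff (kernel s) e (x - y) * v y := by
  have I := integrable_kernel_mul hs1 hv hM hsupp
  have e1 : ∀ y, secDiff (kernel s) e (x - y) * v y =
      kernel s (x + e - y) * v y + kernel s (x - e - y) * v y - 2 * (kernel s (x - y) * v y) := by
    intro y
    rw [secDiff, show x - y + e = x + e - y by abel, show x - y - e = x - e - y by abel]; ring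
  have I3 : Integrable fun y => kernel s (x + e - y) * v y + kernel s (x - e - y) * v y :=
    (I (x + e)).add (I (x - e))
  simp only [e1]
  rw [integral_sub I3 ((I x).const_mul 2), integral_add (I (x + e)) (I (x - e)), integral_const_mul]
  rfl

/-- Young's inequality `L¹ * L^∞`, once the difference has been moved onto the kernel. -/
theorem abs_secDiff_pot_le {s M : ℝ} (hs : 0 < s) (hs1 : s < 1) {v : Plane → ℝ}
    (hv : AEStronglyMeasurable v) (hM : ∀ᵐ y, |v y| ≤ M)
    (hsupp : Bornology.IsBounded (Function.support v)) (e x : Plane) :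
    |secDiff (pot s v) e x| ≤ M * ∫ z, |secDiff (kernel s) e z| := by
  rw [secDiff_pot hs1 hv hM hsupp, ← integral_sub_left_eq_self (fun z => |secDiff (kernel s) e z|)
    volume x, ← integral_const_mul]
  rw [← Real.norm_eq_abs]
  refine norm_integral_le_of_norm_le
    (((integrable_secDiff_kernel hs hs1 e).comp_sub_left x).abs.const_mul M) ?_
  filter_upwards [hM] with y hy
  rw [Real.norm_eq_abs, abs_mul, mul_comm]
  gcongr

/-- The term in `v x` left by symmetrization carries the mean of the differenced kernel, which is
zero. The potential thus takes the same form as `fracLap`. -/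
theorem secDiff_pot_eq {s M : ℝ} (hs : 0 < s) (hs1 : s < 1) {v : Plane → ℝ}
    (hv : AEStronglyMeasurable v) (hM : ∀ᵐ y, |v y| ≤ M)
    (hsupp : Bornology.IsBounded (Function.support v)) (e x : Plane) :
    secDiff (pot s v) e x = (1 / 2) * ∫ z, secDiff (kernel s) e z * secDiff v z x := by
  rw [secDiff_pot hs1 hv hM hsupp, integral_comp_sub_mul (integrable_secDiff_kernel hs hs1 e)
    (secDiff_kernel_neg s e) hv hM, integral_secDiff_kernel hs hs1]
  ring

/-! ### The fractional Laplacian as an absolutely convergent integral -/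

/-- The fractional Laplacian as an integral of second differences. -/
def fracLap (s : ℝ) (u : Plane → ℝ) (x : Plane) : ℝ :=
  -(fracConst 2 s / 2) * ∫ z, ‖z‖ ^ (-2 * s - 2) * secDiff u z x

theorem integrable_rpow_mul_secDiff {s α M B : ℝ} (hs : 0 < s) (hα : 2 * s - 1 < α)
    {v : Plane → ℝ} (hv : AEStronglyMeasurable v) (hM : ∀ᵐ y, |v y| ≤ M) {x : Plane}
    (hx : |v x| ≤ M) (hB : ∀ᵐ z, |secDiff v z x| ≤ B * ‖z‖ ^ (1 + α)) :
    Integrable fun z => ‖z‖ ^ (-2 * s - 2) * secDiff v z x := by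
  have hmeas : AEStronglyMeasurable fun z => ‖z‖ ^ (-2 * s - 2) * secDiff v z x := by
    have : Measurable fun z : Plane => ‖z‖ ^ (-2 * s - 2) := by fun_prop
    exact this.aestronglyMeasurable.mul (aesm_secDiff hv x)
  refine integrable_of_le_of_gt (R := 1) ?_ ?_
  · refine ((integrableOn_norm_rpow_le (p := -2 * s - 2 + (1 + α)) (by linarith) 1).const_mul
      B).mono' hmeas.restrict (ae_restrict_of_ae ?_)
    filter_upwards [hB, Measure.ae_ne volume (0 : Plane)] with z hz hz0
    have hzp : 0 < ‖z‖ := norm_pos_iff.2 hz0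
    rw [Real.norm_eq_abs, abs_mul, abs_of_pos (Real.rpow_pos_of_pos hzp _),
      Real.rpow_add hzp (-2 * s - 2) (1 + α), mul_left_comm]
    gcongr
  · refine ((integrableOn_norm_rpow_gt (p := -2 * s - 2) (by linarith) one_pos).const_mul
      (4 * M)).mono' hmeas.restrict (ae_restrict_of_ae ?_)
    filter_upwards [abs_secDiff_le_of_ae hM hx] with z hz
    rw [Real.norm_eq_abs, abs_mul, abs_of_nonneg (Real.rpow_nonneg (norm_nonneg _) _), mul_comm]
    gcongr

/-- The truncated kernel is even and integrable, so symmetrization is legitimate before the limit;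
the untruncated symmetrized integrand then dominates. -/
theorem hasFracLaplacian_fracLap {s α M B : ℝ} (hs : 0 < s) (hα : 2 * s - 1 < α)
    {v : Plane → ℝ} (hv : AEStronglyMeasurable v) (hM : ∀ᵐ y, |v y| ≤ M) {x : Plane}
    (hx : |v x| ≤ M) (hB : ∀ᵐ z, |secDiff v z x| ≤ B * ‖z‖ ^ (1 + α)) :
    HasFracLaplacian s v x (fracLap s v x) := by
  set G : ℝ → Plane → ℝ := fun ε => {z : Plane | ε < ‖z‖}.indicator fun z => ‖z‖ ^ (-2 * s - 2)
    with hGdef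
  have hG : ∀ ε, 0 < ε → Integrable (G ε) := fun ε hε =>
    (integrable_indicator_iff (measurableSet_norm_gt ε)).2
      (integrableOn_norm_rpow_gt (by linarith) hε)
  have heven : ∀ ε z, G ε (-z) = G ε z := fun ε z => by simp [hGdef, Set.indicator]
  have hms : ∀ ε, MeasurableSet {y : Plane | ε < ‖x - y‖} := fun ε =>
    measurableSet_lt measurable_const (by fun_prop)
  have hind : ∀ ε, {y : Plane | ε < ‖x - y‖}.indicator
      (fun y => (v x - v y) / ‖x - y‖ ^ (2 + 2 * s)) = fun y => G ε (x - y) * (v x - v y) := by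
    intro ε
    ext y
    by_cases hy : ε < ‖x - y‖
    · rw [Set.indicator_of_mem (show y ∈ {y : Plane | ε < ‖x - y‖} from hy)]
      simp only [hGdef]
      rw [Set.indicator_of_mem (show x - y ∈ {z : Plane | ε < ‖z‖} from hy),
        show -2 * s - 2 = -(2 + 2 * s) by ring, Real.rpow_neg (norm_nonneg _)]
      field_simp
    · rw [Set.indicator_of_notMem (show y ∉ {y : Plane | ε < ‖x - y‖} from hy)]
      simp only [hGdef]
      rw [Set.indicator_of_notMem (show x - y ∉ {z : Plane | ε < ‖z‖} from hy), zero_mul]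
  have hI := integrable_rpow_mul_secDiff hs hα hv hM hx hB
  have hw : AEStronglyMeasurable fun y => v x - v y := aestronglyMeasurable_const.sub hv
  have hwM : ∀ᵐ y, |v x - v y| ≤ 2 * M := by
    filter_upwards [hM] with y hy
    exact (abs_sub _ _).trans (by linarith)
  refine ⟨fun ε hε => ?_, ?_⟩
  · rw [← integrable_indicator_iff (hms ε), hind]
    exact integrable_comp_sub_mul (hG ε hε) hw hwM x
  -- The function `y ↦ v x - v y` vanishes at `x`, so symmetrization leaves no mean term.
  · have key : ∀ ε, 0 < ε → fracConst 2 s * ∫ y in {y : Plane | ε < ‖x - y‖},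
        (v x - v y) / ‖x - y‖ ^ (2 + 2 * s) =
        -(fracConst 2 s / 2) * ∫ z, G ε z * secDiff v z x := by
      intro ε hε
      rw [← integral_indicator (hms ε), hind, integral_comp_sub_mul (hG ε hε) (heven ε) hw hwM]
      have : ∀ z, G ε z * secDiff (fun y => v x - v y) z x = -(G ε z * secDiff v z x) := fun z => by
        unfold secDiff; ring
      simp only [this]; rw [integral_neg]; ring
    refine Tendsto.congr' (f₁ := fun ε => -(fracConst 2 s / 2) * ∫ z, G ε z * secDiff v z x)
      (eventually_mem_nhdsWithin.mono fun ε hε => (key ε hε).symm) ?_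
    refine Tendsto.const_mul _ ?_
    refine tendsto_integral_filter_of_dominated_convergence
      (fun z => ‖‖z‖ ^ (-2 * s - 2) * secDiff v z x‖)
      (eventually_mem_nhdsWithin.mono fun ε hε =>
        (hG ε hε).aestronglyMeasurable.mul (aesm_secDiff hv x))
      (Eventually.of_forall fun ε => ae_of_all _ fun z => ?_) hI.norm ?_
    · by_cases hz : ε < ‖z‖
      · simp [hGdef, hz]
      · simp only [hGdef, Set.indicator, Set.mem_ofPred_eq, hz, if_false, zero_mul, norm_zero]
        positivity
    · filter_upwards [Measure.ae_ne volume (0 : Plane)] with z hz0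
      have hzp : 0 < ‖z‖ := norm_pos_iff.2 hz0
      refine tendsto_const_nhds.congr' ?_
      filter_upwards [mem_nhdsWithin_of_mem_nhds (Iio_mem_nhds hzp)] with ε hε
      have hε : ε < ‖z‖ := hε
      simp [hGdef, hε]

/-- The factor `4s²` is the one in the Laplacian of `|z|^{-2s}`; the Gamma factors match by `Γ(t+1)
= tΓ(t)`. -/
theorem fracConst_eq {s : ℝ} (hs : 0 < s) (hs1 : s < 1) :
    fracConst 2 s = 4 * s ^ 2 * rieszConst 2 (s - 1) := by
  have h1 : Real.Gamma (1 - (s - 1)) = (1 - s) * Real.Gamma (1 - s) := by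
    rw [show 1 - (s - 1) = (1 - s) + 1 by ring, Real.Gamma_add_one (by linarith)]
  have h2 : Real.Gamma ((2 : ℕ) / 2 + s) = s * Real.Gamma s := by
    rw [show ((2 : ℕ) / 2 + s : ℝ) = s + 1 by push_cast; ring, Real.Gamma_add_one hs.ne']
  have h3 : ((2 : ℕ) / 2 + (s - 1) : ℝ) = s := by push_cast; ring
  have h4 : (2 : ℝ) ^ (2 * s) = 4 * 2 ^ (2 * (s - 1)) := by
    rw [show 2 * s = (2 : ℕ) + 2 * (s - 1) by push_cast; ring, Real.rpow_add two_pos,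
      Real.rpow_natCast]; norm_num
  have g1 : Real.Gamma (1 - s) ≠ 0 := (Real.Gamma_pos_of_pos (by linarith)).ne'
  have g2 : (1 - s) ≠ 0 := by linarith
  unfold fracConst rieszConst
  rw [h1, h2, h3, h4]
  field_simp
  ring

theorem rieszConst_pos {s : ℝ} (hs : 0 < s) (hs1 : s < 1) : 0 < rieszConst 2 (s - 1) := by
  have h3 : ((2 : ℕ) / 2 + (s - 1) : ℝ) = s := by push_cast; ring
  have g1 : 0 < Real.Gamma (1 - (s - 1)) := Real.Gamma_pos_of_pos (by linarith)
  have g2 : 0 < Real.Gamma s := Real.Gamma_pos_of_pos hs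
  unfold rieszConst
  rw [h3, ← neg_div, show -(2 ^ (2 * (s - 1)) * (s - 1) * Real.Gamma s) =
    2 ^ (2 * (s - 1)) * (1 - s) * Real.Gamma s by ring]
  have : 0 < 1 - s := by linarith
  positivity

/-- Both terms are integrals against the same `secDiff v z x`, and the difference of their kernels
is proportional to `truncErr`. -/
theorem abs_fracLap_add_le {s α M B : ℝ} (hs : 0 < s) (hs1 : s < 1) (hα : 2 * s - 1 < α)
    (hα1 : α ≤ 1) {v : Plane → ℝ} (hv : AEStronglyMeasurable v) (hM : ∀ᵐ y, |v y| ≤ M)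
    (hsupp : Bornology.IsBounded (Function.support v)) {x : Plane}
    (hx : |v x| ≤ M) (hB : ∀ᵐ z, |secDiff v z x| ≤ B * ‖z‖ ^ (1 + α)) {a : Plane} (ha : a ≠ 0) :
    |fracLap s v x + rieszConst 2 (s - 1) *
        ((secDiff (pot s v) a x + secDiff (pot s v) (rot a) x) / ‖a‖ ^ 2)| ≤
      rieszConst 2 (s - 1) / 2 * (B * ∫ z, |truncErr s a z| * ‖z‖ ^ (1 + α)) := by
  have hc := rieszConst_pos hs hs1
  have hI := integrable_rpow_mul_secDiff hs hα hv hM hx hB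
  have hd : ∀ e, Integrable fun z => secDiff (kernel s) e z * secDiff v z x := fun e =>
    (integrable_secDiff_kernel hs hs1 e).mul_bdd (aesm_secDiff hv x) (abs_secDiff_le_of_ae hM hx)
  have hI2 : Integrable fun z => secDiff (kernel s) a z * secDiff v z x +
      secDiff (kernel s) (rot a) z * secDiff v z x := (hd a).add (hd (rot a))
  have e : ∫ z, truncErr s a z * secDiff v z x =
      4 * s ^ 2 * (∫ z, ‖z‖ ^ (-2 * s - 2) * secDiff v z x) -
      (1 / ‖a‖ ^ 2) * ((∫ z, secDiff (kernel s) a z * secDiff v z x) +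
        ∫ z, secDiff (kernel s) (rot a) z * secDiff v z x) := by
    have : ∀ z, truncErr s a z * secDiff v z x =
      4 * s ^ 2 * (‖z‖ ^ (-2 * s - 2) * secDiff v z x) -
      (1 / ‖a‖ ^ 2) * (secDiff (kernel s) a z * secDiff v z x +
        secDiff (kernel s) (rot a) z * secDiff v z x) := fun z => by unfold truncErr; ring
    simp only [this]
    rw [integral_sub (hI.const_mul _) (hI2.const_mul _), integral_const_mul, integral_const_mul,
      integral_add (hd a) (hd (rot a))]
  have e2 : fracLap s v x + rieszConst 2 (s - 1) *
        ((secDiff (pot s v) a x + secDiff (pot s v) (rot a) x) / ‖a‖ ^ 2) =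
      -(rieszConst 2 (s - 1) / 2 * ∫ z, truncErr s a z * secDiff v z x) := by
    rw [e, secDiff_pot_eq hs hs1 hv hM hsupp, secDiff_pot_eq hs hs1 hv hM hsupp, fracLap,
      fracConst_eq hs hs1]
    ring
  rw [e2, abs_neg, abs_mul, abs_of_pos (by positivity : 0 < rieszConst 2 (s - 1) / 2)]
  refine mul_le_mul_of_nonneg_left ?_ (by positivity)
  rw [← integral_const_mul]
  rw [← Real.norm_eq_abs]
  refine norm_integral_le_of_norm_le ((integrable_truncErr_mul hs hs1 hα hα1 ha).const_mul B) ?_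
  filter_upwards [hB] with z hz
  rw [Real.norm_eq_abs, abs_mul, mul_left_comm]
  gcongr

/-! ### Squares and functions of class `C^{1,α}` -/

theorem abs_coord_le_norm (z : Plane) (k : Fin 2) : |z k| ≤ ‖z‖ := PiLp.norm_apply_le z k

theorem isOpen_openSquare (a : ℝ) : IsOpen (openSquare a) := by
  have : openSquare a = ⋂ k : Fin 2, (fun x : Plane => x k) ⁻¹' Set.Ioo (-a) a := by
    ext x; simp [openSquare]
  rw [this]
  exact isOpen_iInter_of_finite fun k => isOpen_Ioo.preimage (by fun_prop)

theorem convex_openSquare (a : ℝ) : Convex ℝ (openSquare a) := by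
  intro x hx y hy p q hp hq hpq k
  have h1 := hx k
  have h2 := hy k
  have hc : Convex ℝ (Set.Ioo (-a) a) := convex_Ioo _ _
  simpa using hc ⟨h1.1, h1.2⟩ ⟨h2.1, h2.2⟩ hp hq hpq

theorem isClosed_closedSquare (L : ℝ) : IsClosed (closedSquare L) := by
  have : closedSquare L = ⋂ k : Fin 2, (fun x : Plane => x k) ⁻¹' Set.Icc (-L) L := by
    ext x; simp [closedSquare]
  rw [this]
  exact isClosed_iInter fun k => isClosed_Icc.preimage (by fun_prop)

theorem isBounded_closedSquare (L : ℝ) : Bornology.IsBounded (closedSquare L) := by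
  refine (Metric.isBounded_closedBall (x := (0 : Plane)) (r := 2 * |L|)).subset fun x hx => ?_
  rw [mem_closedBall_zero_iff]
  have h : ∀ k, x k ^ 2 ≤ L ^ 2 := fun k => by
    have := hx k
    nlinarith
  have h2 : ‖x‖ ^ 2 ≤ (2 * |L|) ^ 2 := by
    rw [norm_sq_eq, mul_pow, sq_abs]; nlinarith [h 0, h 1, sq_nonneg L]
  exact (pow_le_pow_iff_left₀ (norm_nonneg _) (by positivity) two_ne_zero).1 h2

theorem isCompact_closedSquare (L : ℝ) : IsCompact (closedSquare L) :=
  Metric.isCompact_of_isClosed_isBounded (isClosed_closedSquare L) (isBounded_closedSquare L)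

theorem add_mem_openSquare {L δ : ℝ} {x z : Plane} (hx : x ∈ closedSquare L) (hz : ‖z‖ < δ) :
    x + z ∈ openSquare (L + δ) := by
  intro k
  have h1 := hx k
  have h2 := abs_le.1 ((abs_coord_le_norm z k).trans hz.le)
  have h3 := abs_lt.1 ((abs_coord_le_norm z k).trans_lt hz)
  simp only [PiLp.add_apply]
  constructor <;> linarith [h1.1, h1.2, h3.1, h3.2]

theorem closedSquare_subset_openSquare {L δ : ℝ} (hδ : 0 < δ) :
    closedSquare L ⊆ openSquare (L + δ) := fun x hx => by
  simpa using add_mem_openSquare (z := 0) hx (by simpa using hδ)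

/-- Mean value inequality on the convex set `U ∩ closedBall x ‖y - x‖`: intersecting with the ball
makes the Hölder bound on the derivative uniform in terms of `‖y - x‖`. -/
theorem C1Holder.exists_taylor {α : ℝ} (hα : 0 ≤ α) {u : Plane → ℝ} {U : Set Plane}
    (hU : IsOpen U) (hc : Convex ℝ U) (hu : C1Holder α u U) :
    ∃ K : ℝ, 0 ≤ K ∧ ∀ x ∈ U, ∀ y ∈ U,
      |u y - u x - fderiv ℝ u x (y - x)| ≤ K * ‖y - x‖ ^ (1 + α) := by
  obtain ⟨h1, -, K, hK⟩ := hu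
  refine ⟨|K|, abs_nonneg _, fun x hx y hy => ?_⟩
  have hd : ∀ w ∈ U ∩ Metric.closedBall x ‖y - x‖,
      HasFDerivWithinAt u (fderiv ℝ u w) (U ∩ Metric.closedBall x ‖y - x‖) w := fun w hw =>
    ((h1.differentiableOn one_ne_zero).differentiableAt
      (hU.mem_nhds hw.1)).hasFDerivAt.hasFDerivWithinAt
  have hb : ∀ w ∈ U ∩ Metric.closedBall x ‖y - x‖,
      ‖fderiv ℝ u w - fderiv ℝ u x‖ ≤ |K| * ‖y - x‖ ^ α := fun w hw => by
    have hwx : ‖w - x‖ ≤ ‖y - x‖ := by simpa [dist_eq_norm] using hw.2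
    calc ‖fderiv ℝ u w - fderiv ℝ u x‖ ≤ K * ‖w - x‖ ^ α := hK w hw.1 x hx
      _ ≤ |K| * ‖w - x‖ ^ α := by gcongr; exact le_abs_self K
      _ ≤ |K| * ‖y - x‖ ^ α := by gcongr
  have := Convex.norm_image_sub_le_of_norm_hasFDerivWithin_le' hd hb
    (hc.inter (convex_closedBall _ _)) ⟨hx, Metric.mem_closedBall_self (norm_nonneg _)⟩
    ⟨hy, by simp [dist_eq_norm]⟩
  rw [Real.norm_eq_abs] at this
  refine this.trans (le_of_eq ?_)
  rcases eq_or_ne y x with rfl | hne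
  · simp [Real.zero_rpow (by linarith : 1 + α ≠ 0)]
  · rw [Real.rpow_add (norm_pos_iff.2 (sub_ne_zero.2 hne)), Real.rpow_one]; ring

theorem abs_secDiff_le_of_taylor {K α : ℝ} {u : Plane → ℝ} {U : Set Plane}
    (hK : ∀ x ∈ U, ∀ y ∈ U, |u y - u x - fderiv ℝ u x (y - x)| ≤ K * ‖y - x‖ ^ (1 + α))
    {x z : Plane} (hx : x ∈ U) (h1 : x + z ∈ U) (h2 : x - z ∈ U) :
    |secDiff u z x| ≤ 2 * K * ‖z‖ ^ (1 + α) := by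
  have k1 := hK x hx _ h1
  have k2 := hK x hx _ h2
  rw [add_sub_cancel_left] at k1
  rw [sub_sub_cancel_left, norm_neg, map_neg] at k2
  have e : secDiff u z x = (u (x + z) - u x - fderiv ℝ u x z) +
      (u (x - z) - u x - -fderiv ℝ u x z) := by unfold secDiff; ring
  rw [e]
  refine (abs_add_le _ _).trans ?_
  linarith

theorem ae_abs_secDiff_le {K M L δ α : ℝ} (hδ : 0 < δ) (hα : 0 ≤ α) {u : Plane → ℝ}
    (hK0 : 0 ≤ K) (hK : ∀ x ∈ openSquare (L + δ), ∀ y ∈ openSquare (L + δ),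
      |u y - u x - fderiv ℝ u x (y - x)| ≤ K * ‖y - x‖ ^ (1 + α))
    (hM : ∀ᵐ y, |u y| ≤ M) {x : Plane} (hx : x ∈ closedSquare L) (hxM : |u x| ≤ M) :
    ∀ᵐ z, |secDiff u z x| ≤ (2 * K + 4 * M / δ ^ (1 + α)) * ‖z‖ ^ (1 + α) := by
  have hM0 : 0 ≤ M := (abs_nonneg _).trans hxM
  filter_upwards [abs_secDiff_le_of_ae hM hxM] with z hz
  rw [add_mul]
  have hδp : 0 < δ ^ (1 + α) := Real.rpow_pos_of_pos hδ _
  have p1 : 0 ≤ 2 * K * ‖z‖ ^ (1 + α) := by positivity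
  have p2 : 0 ≤ 4 * M / δ ^ (1 + α) * ‖z‖ ^ (1 + α) := by positivity
  rcases lt_or_ge ‖z‖ δ with h | h
  · have := abs_secDiff_le_of_taylor hK (closedSquare_subset_openSquare hδ hx)
      (add_mem_openSquare hx h)
      (by rw [sub_eq_add_neg]; exact add_mem_openSquare hx (by rwa [norm_neg]))
    linarith
  -- For `‖z‖ ≥ δ` the trivial bound is absorbed, since `(‖z‖/δ)^{1+α} ≥ 1`.
  · have : 4 * M ≤ 4 * M / δ ^ (1 + α) * ‖z‖ ^ (1 + α) := by
      rw [div_mul_eq_mul_div, le_div_iff₀ hδp]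
      gcongr
    linarith

/-! ### Bilinear interpolation -/

/-- The one-dimensional hat function of mesh size one. -/
def tent (t : ℝ) : ℝ := max 0 (1 - |t|)

theorem tent_nonneg (t : ℝ) : 0 ≤ tent t := le_max_left _ _

theorem tent_eq_zero {t : ℝ} (h : 1 ≤ |t|) : tent t = 0 := max_eq_left (by linarith)

theorem tent_of_abs_le {t : ℝ} (h : |t| ≤ 1) : tent t = 1 - |t| := max_eq_right (by linarith)

theorem hat_eq {h : ℝ} (hh : 0 < h) (z : Plane) : hat h z = tent (z 0 / h) * tent (z 1 / h) := by
  have e : ∀ t : ℝ, |t / h| = |t| / h := fun t => by rw [abs_div, abs_of_pos hh]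
  unfold hat
  split_ifs with hz
  · have h' : ∀ k, |z k / h| ≤ 1 := fun k => by
      rw [e, div_le_one hh]; exact abs_le.2 ⟨(hz k).1.le, (hz k).2.le⟩
    rw [tent_of_abs_le (h' 0), tent_of_abs_le (h' 1), e, e]
  · have : ∃ k, 1 ≤ |z k / h| := by
      by_contra hcon
      push Not at hcon
      refine hz fun k => ?_
      have := hcon k
      rw [e, div_lt_one hh] at this
      exact abs_lt.1 this
    rcases Fin.exists_fin_two.1 this with hk | hk
    · rw [tent_eq_zero hk, zero_mul]
    · rw [tent_eq_zero hk, mul_zero]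

/-- Only the two ends of the cell containing `τ` contribute. The cell is chosen independently of
`c`, so constants and linear functions are both read off from this formula. -/
theorem sum_tent_mul {N : ℕ} (hN : 1 ≤ N) {τ : ℝ} (h0 : 0 ≤ τ) (h1 : τ ≤ N) :
    ∃ m : ℤ, ∀ c : ℤ → ℝ, ∑ p ∈ Finset.Icc (0 : ℤ) N, tent (τ - p) * c p =
      (m + 1 - τ) * c m + (τ - m) * c (m + 1) := by
  obtain ⟨m, hm0, hmN, hm1, hm2⟩ : ∃ m : ℤ, 0 ≤ m ∧ m + 1 ≤ N ∧ (m : ℝ) ≤ τ ∧ τ ≤ m + 1 := by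
    rcases lt_or_eq_of_le h1 with h | h
    · refine ⟨⌊τ⌋, Int.floor_nonneg.2 h0, ?_, Int.floor_le _, (Int.lt_floor_add_one _).le⟩
      have : ⌊τ⌋ < (N : ℤ) := Int.floor_lt.2 (by exact_mod_cast h)
      omega
    -- At the right end `τ = N` the floor would give a cell outside the grid, so the last cell is
    -- used.
    · refine ⟨N - 1, by omega, by omega, ?_, ?_⟩ <;> push_cast <;> linarith
  refine ⟨m, fun c => ?_⟩
  have hsub : ({m, m + 1} : Finset ℤ) ⊆ Finset.Icc (0 : ℤ) N := by
    intro p hp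
    simp only [Finset.mem_insert, Finset.mem_singleton] at hp
    rw [Finset.mem_Icc]; omega
  rw [← Finset.sum_subset hsub, Finset.sum_pair (by omega)]
  · rw [tent_of_abs_le (by rw [abs_of_nonneg] <;> linarith),
      tent_of_abs_le (by push_cast; rw [abs_of_nonpos] <;> linarith),
      abs_of_nonneg (by linarith), abs_of_nonpos (by push_cast; linarith)]
    push_cast; ring
  · intro p _ hp
    simp only [Finset.mem_insert, Finset.mem_singleton, not_or] at hp
    rw [tent_eq_zero, zero_mul]
    rcases lt_or_gt_of_ne hp.1 with h | h
    · have : (p : ℝ) + 1 ≤ m := by exact_mod_cast h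
      rw [le_abs]; left; linarith
    · have : (m : ℝ) + 1 + 1 ≤ p := by exact_mod_cast (by omega : m + 1 + 1 ≤ p)
      rw [le_abs]; right; linarith

theorem sum_tent {N : ℕ} (hN : 1 ≤ N) {τ : ℝ} (h0 : 0 ≤ τ) (h1 : τ ≤ N) :
    ∑ p ∈ Finset.Icc (0 : ℤ) N, tent (τ - p) = 1 := by
  obtain ⟨m, hm⟩ := sum_tent_mul hN h0 h1
  have := hm fun _ => 1
  simp only [mul_one] at this
  rw [this]; ring

theorem sum_tent_mul_sub {N : ℕ} (hN : 1 ≤ N) {τ : ℝ} (h0 : 0 ≤ τ) (h1 : τ ≤ N) :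
    ∑ p ∈ Finset.Icc (0 : ℤ) N, tent (τ - p) * (p - τ) = 0 := by
  obtain ⟨m, hm⟩ := sum_tent_mul hN h0 h1
  rw [hm fun p => (p : ℝ) - τ]; push_cast; ring

/-- The indices of all grid nodes in the closed square. -/
def nodeIdx (N : ℕ) : Finset (ℤ × ℤ) := Finset.Icc 0 (N : ℤ) ×ˢ Finset.Icc 0 (N : ℤ)

theorem mesh_pos {L : ℝ} (hL : 0 < L) {N : ℕ} (hN : 1 ≤ N) : 0 < mesh L N := by
  have : (0 : ℝ) < N := by exact_mod_cast hN
  unfold mesh; positivity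

theorem mul_mesh {L : ℝ} {N : ℕ} (hN : 1 ≤ N) : N * mesh L N = 2 * L := by
  have : (N : ℝ) ≠ 0 := by positivity
  unfold mesh; field_simp

theorem hat_sub_gridPoint {L : ℝ} (hL : 0 < L) {N : ℕ} (hN : 1 ≤ N) (p q : ℤ) (y : Plane) :
    hat (mesh L N) (y - gridPoint L N p q) =
      tent ((y 0 + L) / mesh L N - p) * tent ((y 1 + L) / mesh L N - q) := by
  have hh := mesh_pos hL hN
  rw [hat_eq hh]
  congr 2 <;> simp [gridPoint] <;> field_simp <;> ring

theorem hat_nonneg {h : ℝ} (hh : 0 < h) (z : Plane) : 0 ≤ hat h z := by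
  rw [hat_eq hh]; exact mul_nonneg (tent_nonneg _) (tent_nonneg _)

theorem hat_eq_zero_of_notMem {h : ℝ} {z : Plane} (hz : z ∉ openSquare h) : hat h z = 0 := by
  unfold hat; rw [if_neg hz]

/-- The cutoff to the neighbouring cells is harmless because the hat already vanishes off the open
cell. -/
theorem basisFun_eq_of_mem {L : ℝ} {N : ℕ} {p q : ℤ} {y : Plane} (hy : y ∈ closedSquare L) :
    basisFun L N p q y = hat (mesh L N) (y - gridPoint L N p q) := by
  unfold basisFun
  by_cases h : y - gridPoint L N p q ∈ openSquare (mesh L N)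
  · rw [Set.indicator_of_mem]
    refine ⟨fun k => ?_, hy⟩
    have := h k
    rw [PiLp.sub_apply] at this
    exact abs_le.2 ⟨this.1.le, this.2.le⟩
  · rw [hat_eq_zero_of_notMem h]
    simp only [Set.indicator_apply_eq_zero]
    exact fun _ => hat_eq_zero_of_notMem h

theorem basisFun_eq_zero_of_notMem {L : ℝ} {N : ℕ} {p q : ℤ} {y : Plane}
    (hy : y ∉ closedSquare L) : basisFun L N p q y = 0 :=
  Set.indicator_of_notMem (fun h => hy h.2) _

theorem coord_div_mesh_mem {L : ℝ} (hL : 0 < L) {N : ℕ} (hN : 1 ≤ N) {y : Plane}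
    (hy : y ∈ closedSquare L) (k : Fin 2) :
    0 ≤ (y k + L) / mesh L N ∧ (y k + L) / mesh L N ≤ N := by
  have hh := mesh_pos hL hN
  have := hy k
  refine ⟨div_nonneg (by linarith) hh.le, ?_⟩
  rw [div_le_iff₀ hh, mul_mesh hN]; linarith

theorem sum_basisFun {L : ℝ} (hL : 0 < L) {N : ℕ} (hN : 1 ≤ N) {y : Plane}
    (hy : y ∈ closedSquare L) : ∑ k ∈ nodeIdx N, basisFun L N k.1 k.2 y = 1 := by
  have c := coord_div_mesh_mem hL hN hy
  simp only [basisFun_eq_of_mem hy, hat_sub_gridPoint hL hN, nodeIdx]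
  rw [Finset.sum_product]
  simp only [← Finset.mul_sum, sum_tent hN (c 1).1 (c 1).2, mul_one]
  exact sum_tent hN (c 0).1 (c 0).2

/-- Exactness on linear functions; each coordinate reduces to the one-dimensional first moment times
a partition of unity. -/
theorem sum_basisFun_smul_sub {L : ℝ} (hL : 0 < L) {N : ℕ} (hN : 1 ≤ N) {y : Plane}
    (hy : y ∈ closedSquare L) :
    ∑ k ∈ nodeIdx N, basisFun L N k.1 k.2 y • (gridPoint L N k.1 k.2 - y) = 0 := by
  have c := coord_div_mesh_mem hL hN hy
  have hh := mesh_pos hL hN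
  have e : ∀ (p : ℤ) (t : ℝ), -L + p * mesh L N - t =
      mesh L N * (p - (t + L) / mesh L N) := fun p t => by field_simp; ring
  ext k
  simp only [basisFun_eq_of_mem hy, hat_sub_gridPoint hL hN, nodeIdx]
  fin_cases k
  · simp only [gridPoint, WithLp.ofLp_sum, Finset.sum_apply, PiLp.smul_apply, PiLp.sub_apply,
      smul_eq_mul, Fin.zero_eta, PiLp.zero_apply]
    rw [Finset.sum_product, ← mul_zero (mesh L N), ← sum_tent_mul_sub hN (c 0).1 (c 0).2,
      Finset.mul_sum]
    refine Finset.sum_congr rfl fun p _ => ?_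
    simp only [Matrix.cons_val_zero, e]
    rw [← Finset.sum_mul, ← Finset.mul_sum, sum_tent hN (c 1).1 (c 1).2]
    ring
  · simp only [gridPoint, WithLp.ofLp_sum, Finset.sum_apply, PiLp.smul_apply, PiLp.sub_apply,
      smul_eq_mul, Fin.mk_one, PiLp.zero_apply]
    rw [Finset.sum_product_right, ← mul_zero (mesh L N), ← sum_tent_mul_sub hN (c 1).1 (c 1).2,
      Finset.mul_sum]
    refine Finset.sum_congr rfl fun p _ => ?_
    simp only [Matrix.cons_val_one, Matrix.cons_val_zero, e]
    rw [← Finset.sum_mul, ← Finset.sum_mul, sum_tent hN (c 0).1 (c 0).2]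
    ring

theorem gridPoint_mem {L : ℝ} (hL : 0 < L) {N : ℕ} (hN : 1 ≤ N) {k : ℤ × ℤ}
    (hk : k ∈ nodeIdx N) : gridPoint L N k.1 k.2 ∈ closedSquare L := by
  have hh := mesh_pos hL hN
  have hNh := mul_mesh (L := L) hN
  simp only [nodeIdx, Finset.mem_product, Finset.mem_Icc] at hk
  have key : ∀ p : ℤ, 0 ≤ p → p ≤ N → -L ≤ -L + p * mesh L N ∧ -L + p * mesh L N ≤ L := by
    intro p h0 h1
    have h0' : (0 : ℝ) ≤ p := by exact_mod_cast h0
    have h1' : (p : ℝ) ≤ N := by exact_mod_cast h1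
    constructor <;> nlinarith
  intro i
  fin_cases i
  · simpa [gridPoint] using key k.1 hk.1.1 hk.1.2
  · simpa [gridPoint] using key k.2 hk.2.1 hk.2.2

/-- The interpolant of `u` on the square, extended by the exterior data `g`. -/
def interp (L : ℝ) (N : ℕ) (u g : Plane → ℝ) (y : Plane) : ℝ :=
  g y + ∑ k ∈ nodeIdx N, u (gridPoint L N k.1 k.2) * basisFun L N k.1 k.2 y

theorem norm_le_of_mem_openSquare {h : ℝ} {z : Plane} (hz : z ∈ openSquare h) : ‖z‖ ≤ 2 * h := by
  have h0 : 0 ≤ h := by linarith [(hz 0).1, (hz 0).2]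
  have h1 : ∀ k, z k ^ 2 ≤ h ^ 2 := fun k => by
    have := hz k
    nlinarith
  have h2 : ‖z‖ ^ 2 ≤ (2 * h) ^ 2 := by
    rw [norm_sq_eq]; nlinarith [h1 0, h1 1, sq_nonneg h]
  exact (pow_le_pow_iff_left₀ (norm_nonneg _) (by positivity) two_ne_zero).1 h2

/-- Expanding at `y`, the linear part drops out by exactness, leaving a convex combination of Taylor
remainders at nodes within `2h`. Outside the square the interpolant equals `u`. -/
theorem abs_sub_interp_le {K L δ α : ℝ} (hL : 0 < L) (hδ : 0 < δ) (hα : 0 ≤ α)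
    {u g : Plane → ℝ} (hK0 : 0 ≤ K)
    (hK : ∀ x ∈ openSquare (L + δ), ∀ y ∈ openSquare (L + δ),
      |u y - u x - fderiv ℝ u x (y - x)| ≤ K * ‖y - x‖ ^ (1 + α))
    (hg0 : ∀ x ∈ closedSquare L, g x = 0) (hug : ∀ x ∉ closedSquare L, u x = g x)
    {N : ℕ} (hN : 1 ≤ N) (y : Plane) :
    |u y - interp L N u g y| ≤ K * (2 * mesh L N) ^ (1 + α) := by
  have hh := mesh_pos hL hN
  by_cases hy : y ∈ closedSquare L
  · have hs := sum_basisFun hL hN hy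
    have hlin : ∑ k ∈ nodeIdx N, basisFun L N k.1 k.2 y *
        fderiv ℝ u y (gridPoint L N k.1 k.2 - y) = 0 := by
      have := congrArg (fderiv ℝ u y) (sum_basisFun_smul_sub hL hN hy)
      simpa only [map_sum, map_smul, smul_eq_mul, map_zero] using this
    have e : u y - interp L N u g y = -∑ k ∈ nodeIdx N, basisFun L N k.1 k.2 y *
        (u (gridPoint L N k.1 k.2) - u y - fderiv ℝ u y (gridPoint L N k.1 k.2 - y)) := by
      have e1 : ∀ k : ℤ × ℤ, basisFun L N k.1 k.2 y *
          (u (gridPoint L N k.1 k.2) - u y - fderiv ℝ u y (gridPoint L N k.1 k.2 - y)) =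
          u (gridPoint L N k.1 k.2) * basisFun L N k.1 k.2 y - basisFun L N k.1 k.2 y * u y -
            basisFun L N k.1 k.2 y * fderiv ℝ u y (gridPoint L N k.1 k.2 - y) := fun k => by ring
      simp only [e1, Finset.sum_sub_distrib]
      rw [hlin, ← Finset.sum_mul, hs, interp, hg0 y hy]
      ring
    rw [e, abs_neg]
    refine (Finset.abs_sum_le_sum_abs _ _).trans ?_
    have e2 : K * (2 * mesh L N) ^ (1 + α) = ∑ k ∈ nodeIdx N,
        basisFun L N k.1 k.2 y * (K * (2 * mesh L N) ^ (1 + α)) := by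
      rw [← Finset.sum_mul, hs, one_mul]
    rw [e2]
    refine Finset.sum_le_sum fun k hk => ?_
    have hb : 0 ≤ basisFun L N k.1 k.2 y := by
      rw [basisFun_eq_of_mem hy]; exact hat_nonneg hh _
    rw [abs_mul, abs_of_nonneg hb]
    by_cases hz : y - gridPoint L N k.1 k.2 ∈ openSquare (mesh L N)
    · refine mul_le_mul_of_nonneg_left ?_ hb
      refine (hK y (closedSquare_subset_openSquare hδ hy) _
        (closedSquare_subset_openSquare hδ (gridPoint_mem hL hN hk))).trans ?_
      rw [norm_sub_rev]
      gcongr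
      exact norm_le_of_mem_openSquare hz
    · rw [basisFun_eq_of_mem hy, hat_eq_zero_of_notMem hz, zero_mul, zero_mul]
  · have : u y - interp L N u g y = 0 := by
      simp [interp, basisFun_eq_zero_of_notMem hy, hug y hy]
    rw [this, abs_zero]; positivity

/-! ### The scheme as a discretization of a Riesz potential -/

theorem continuous_tent : Continuous tent := by unfold tent; fun_prop

theorem tent_le_one (t : ℝ) : tent t ≤ 1 := max_le zero_le_one (by linarith [abs_nonneg t])

theorem continuous_hat {h : ℝ} (hh : 0 < h) : Continuous (hat h) := by
  have : hat h = fun z => tent (z 0 / h) * tent (z 1 / h) := funext (hat_eq hh)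
  have ht := continuous_tent
  rw [this]; fun_prop

theorem basisFun_eq_indicator (L : ℝ) (N : ℕ) (p q : ℤ) :
    basisFun L N p q =
      (closedSquare L).indicator fun y => hat (mesh L N) (y - gridPoint L N p q) := by
  ext y
  by_cases hy : y ∈ closedSquare L
  · rw [Set.indicator_of_mem hy, basisFun_eq_of_mem hy]
  · rw [Set.indicator_of_notMem hy, basisFun_eq_zero_of_notMem hy]

theorem aesm_basisFun {L : ℝ} (hL : 0 < L) {N : ℕ} (hN : 1 ≤ N) (p q : ℤ) :
    AEStronglyMeasurable (basisFun L N p q) := by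
  rw [basisFun_eq_indicator]
  have := continuous_hat (mesh_pos hL hN)
  exact (by fun_prop : Continuous fun y => hat (mesh L N) (y - gridPoint L N p q)).aestronglyMeasurable.indicator
    (isClosed_closedSquare L).measurableSet

theorem abs_basisFun_le {L : ℝ} (hL : 0 < L) {N : ℕ} (hN : 1 ≤ N) (p q : ℤ) (y : Plane) :
    |basisFun L N p q y| ≤ 1 := by
  by_cases hy : y ∈ closedSquare L
  · rw [basisFun_eq_of_mem hy, abs_of_nonneg (hat_nonneg (mesh_pos hL hN) _),
      hat_eq (mesh_pos hL hN)]
    exact mul_le_one₀ (tent_le_one _) (tent_nonneg _) (tent_le_one _)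
  · simp [basisFun_eq_zero_of_notMem hy]

theorem integrable_kernel_mul_basisFun {s : ℝ} (hs1 : s < 1) {L : ℝ} (hL : 0 < L) {N : ℕ}
    (hN : 1 ≤ N) (p q : ℤ) (x : Plane) :
    Integrable fun y => kernel s (x - y) * basisFun L N p q y :=
  integrable_kernel_mul hs1 (aesm_basisFun hL hN p q)
    (ae_of_all _ (abs_basisFun_le hL hN p q))
    ((isBounded_closedSquare L).subset fun y hy => by
      by_contra h
      exact hy (basisFun_eq_zero_of_notMem h)) x

/-- The hat at an interior node is supported in the square, so the restriction cuts nothing off and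
translation to the node applies. -/
theorem omegaBar_eq {s L : ℝ} (hL : 0 < L) {N : ℕ} (hN : 1 ≤ N) {k : ℤ × ℤ}
    (hk : k ∈ interiorIdx N) (i j : ℤ) :
    omegaBar s L N (k.1 - i) (k.2 - j) = rieszConst 2 (s - 1) *
      ∫ y, kernel s (gridPoint L N i j - y) * basisFun L N k.1 k.2 y := by
  have hh := mesh_pos hL hN
  have hNh := mul_mesh (L := L) hN
  unfold omegaBar
  congr 1
  rw [← integral_add_left_eq_self (fun y => kernel s (gridPoint L N i j - y) *
    basisFun L N k.1 k.2 y) (gridPoint L N k.1 k.2)]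
  congr 1
  ext ζ
  have hb : basisFun L N k.1 k.2 (gridPoint L N k.1 k.2 + ζ) = hat (mesh L N) ζ := by
    by_cases hm : gridPoint L N k.1 k.2 + ζ ∈ closedSquare L
    · rw [basisFun_eq_of_mem hm, add_sub_cancel_left]
    · rw [basisFun_eq_zero_of_notMem hm, hat_eq_zero_of_notMem]
      intro hζ
      refine hm ?_
      simp only [interiorIdx, Finset.mem_product, Finset.mem_Icc] at hk
      have key : ∀ (p : ℤ) (t : ℝ), 1 ≤ p → p ≤ N - 1 → -mesh L N < t ∧ t < mesh L N →
          -L ≤ -L + p * mesh L N + t ∧ -L + p * mesh L N + t ≤ L := by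
        intro p t h0 h1 ht
        have h0' : (1 : ℝ) ≤ p := by exact_mod_cast h0
        have h1' : (p : ℝ) + 1 ≤ N := by exact_mod_cast (by omega : p + 1 ≤ (N : ℤ))
        constructor <;> nlinarith [ht.1, ht.2]
      refine Fin.forall_fin_two.2 ⟨?_, ?_⟩
      · simpa [gridPoint] using key k.1 (ζ 0) hk.1.1 hk.1.2 (hζ 0)
      · simpa [gridPoint] using key k.2 (ζ 1) hk.2.1 hk.2.2 (hζ 1)
  rw [hb, kernel]
  congr 2
  rw [← norm_neg]
  congr 1
  ext l
  fin_cases l <;> simp [gridPoint] <;> ring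

theorem boundaryIdx_eq (N : ℕ) :
    boundaryIdx N = (nodeIdx N).filter fun k : ℤ × ℤ => k.1 * k.2 * (k.1 - N) * (k.2 - N) = 0 := rfl

theorem interiorIdx_eq (N : ℕ) :
    interiorIdx N = (nodeIdx N).filter fun k : ℤ × ℤ => ¬ k.1 * k.2 * (k.1 - N) * (k.2 - N) = 0 := by
  ext k
  simp only [interiorIdx, nodeIdx, Finset.mem_filter, Finset.mem_product, Finset.mem_Icc,
    mul_eq_zero, not_or]
  omega

theorem mem_interiorIdx_iff {N : ℕ} {k : ℤ × ℤ} (hk : k ∈ nodeIdx N) :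
    k ∈ interiorIdx N ↔ k ∉ boundaryIdx N := by
  rw [boundaryIdx_eq, interiorIdx_eq, Finset.mem_filter, Finset.mem_filter]
  tauto

theorem rieszConst_mul_pot_interp {s L : ℝ} (hs1 : s < 1) (hL : 0 < L) {u g : Plane → ℝ}
    {M : ℝ} (hg : AEStronglyMeasurable g) (hgM : ∀ᵐ y, |g y| ≤ M)
    (hgsupp : Bornology.IsBounded (Function.support g)) {N : ℕ} (hN : 1 ≤ N) (i j : ℤ) :
    rieszConst 2 (s - 1) * pot s (interp L N u g) (gridPoint L N i j) =
      ∑ k ∈ interiorIdx N, omegaBar s L N (k.1 - i) (k.2 - j) * u (gridPoint L N k.1 k.2) +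
        remainder s L N u g i j := by
  set x := gridPoint L N i j with hx
  have I1 := integrable_kernel_mul hs1 hg hgM hgsupp x
  have I2 : ∀ k : ℤ × ℤ, Integrable fun y =>
      kernel s (x - y) * (u (gridPoint L N k.1 k.2) * basisFun L N k.1 k.2 y) := fun k => by
    refine ((integrable_kernel_mul_basisFun hs1 hL hN k.1 k.2 x).const_mul
      (u (gridPoint L N k.1 k.2))).congr (ae_of_all _ fun y => ?_)
    simp only; ring
  have e : pot s (interp L N u g) x = (∫ y, kernel s (x - y) * g y) + ∑ k ∈ nodeIdx N,
      ∫ y, kernel s (x - y) * (u (gridPoint L N k.1 k.2) * basisFun L N k.1 k.2 y) := by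
    simp only [pot, interp, mul_add, Finset.mul_sum]
    rw [integral_add I1 (integrable_finsetSum _ fun k _ => I2 k),
      integral_finsetSum _ fun k _ => I2 k]
  have e2 : ∀ k ∈ interiorIdx N,
      omegaBar s L N (k.1 - i) (k.2 - j) * u (gridPoint L N k.1 k.2) =
      rieszConst 2 (s - 1) *
        ∫ y, kernel s (x - y) * (u (gridPoint L N k.1 k.2) * basisFun L N k.1 k.2 y) := by
    intro k hk
    rw [omegaBar_eq hL hN hk, mul_assoc, mul_comm (integral _ _), ← integral_const_mul]
    congr 2
    ext y
    ring
  rw [Finset.sum_congr rfl e2, e, ← Finset.sum_filter_add_sum_filter_not (nodeIdx N)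
    (fun k : ℤ × ℤ => k.1 * k.2 * (k.1 - N) * (k.2 - N) = 0), ← boundaryIdx_eq, ← interiorIdx_eq,
    ← Finset.mul_sum]
  unfold remainder
  simp only [kernel]
  ring

/-! ### Algebra of the discrete Laplacian -/

theorem negLap_sum {ι : Type*} (h θ : ℝ) (F : ι → ℤ → ℤ → ℝ) (S : Finset ι) (i j : ℤ) :
    negLap h θ (fun i j => ∑ k ∈ S, F k i j) i j = ∑ k ∈ S, negLap h θ (F k) i j := by
  simp only [negLap, negLap1, negLap2, Finset.sum_add_distrib, ← Finset.mul_sum,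
    Finset.sum_neg_distrib, Finset.sum_sub_distrib, ← Finset.sum_div]

theorem negLap_add (h θ : ℝ) (v w : ℤ → ℤ → ℝ) (i j : ℤ) :
    negLap h θ v i j + negLap h θ w i j = negLap h θ (fun i j => v i j + w i j) i j := by
  simp only [negLap, negLap1, negLap2]; ring

/-- Both stencils are invariant under reflection, so differencing the weights is differencing in the
evaluation node. -/
theorem negLap_reflect (h θ c : ℝ) (w : ℤ → ℤ → ℝ) (a b i j : ℤ) :
    negLap h θ w (a - i) (b - j) * c = negLap h θ (fun i j => w (a - i) (b - j) * c) i j := by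
  have e1 : ∀ a i : ℤ, a - (i - 1) = a - i + 1 := fun a i => by ring
  have e2 : ∀ a i : ℤ, a - (i + 1) = a - i - 1 := fun a i => by ring
  simp only [negLap, negLap1, negLap2, e1, e2]; ring

theorem negLap_congr {h θ : ℝ} {v w : ℤ → ℤ → ℝ} {i j : ℤ}
    (H : ∀ i' j', |i' - i| ≤ 1 → |j' - j| ≤ 1 → v i' j' = w i' j') :
    negLap h θ v i j = negLap h θ w i j := by
  have a : |i - 1 - i| ≤ 1 := by simp
  have b : |i + 1 - i| ≤ 1 := by simp
  have c : |j - 1 - j| ≤ 1 := by simp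
  have d : |j + 1 - j| ≤ 1 := by simp
  have e : |i - i| ≤ 1 := by simp
  have f : |j - j| ≤ 1 := by simp
  simp only [negLap, negLap1, negLap2]
  rw [H _ _ a c, H _ _ a d, H _ _ a f, H _ _ b c, H _ _ b d, H _ _ b f, H _ _ e c, H _ _ e d,
    H _ _ e f]

/-- The correction enters through the central weight at interior nodes and through `remainderM` at
boundary nodes; together they give `c00 * u` on the whole stencil. -/
theorem schemeM_eq {s L : ℝ} (hs1 : s < 1) (hL : 0 < L) {u g : Plane → ℝ}
    {M : ℝ} (hg : AEStronglyMeasurable g) (hgM : ∀ᵐ y, |g y| ≤ M)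
    (hgsupp : Bornology.IsBounded (Function.support g)) {N : ℕ} (hN : 1 ≤ N) (θ c00 : ℝ)
    {i j : ℤ} (hij : (i, j) ∈ interiorIdx N) :
    schemeM s L N θ c00 u (remainderM s L N c00 u g) i j =
      negLap (mesh L N) θ (fun i j => rieszConst 2 (s - 1) *
        pot s (interp L N u g) (gridPoint L N i j) + c00 * u (gridPoint L N i j)) i j := by
  unfold schemeM weightM
  simp only [negLap_reflect]
  rw [← negLap_sum, negLap_add]
  refine negLap_congr fun i' j' hi hj => ?_
  -- The stencil of an interior node never leaves the closed grid.
  have hm : (i', j') ∈ nodeIdx N := by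
    simp only [interiorIdx, nodeIdx, Finset.mem_product, Finset.mem_Icc] at hij ⊢
    rw [abs_le] at hi hj
    omega
  rw [rieszConst_mul_pot_interp hs1 hL hg hgM hgsupp hN]
  simp only [omegaBarM, add_mul, Finset.sum_add_distrib, remainderM]
  have e : ∑ k ∈ interiorIdx N, (if k.1 - i' = 0 ∧ k.2 - j' = 0 then c00 else 0) *
      u (gridPoint L N k.1 k.2) =
      if (i', j') ∈ interiorIdx N then c00 * u (gridPoint L N i' j') else 0 := by
    rw [← Finset.sum_ite_eq' (interiorIdx N) (i', j')
      fun k => c00 * u (gridPoint L N k.1 k.2)]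
    refine Finset.sum_congr rfl fun k _ => ?_
    have : (k.1 - i' = 0 ∧ k.2 - j' = 0) ↔ k = (i', j') := by
      rw [sub_eq_zero, sub_eq_zero, Prod.ext_iff]
    simp only [this, ite_mul, zero_mul]
  rw [e]
  by_cases hb : (i', j') ∈ boundaryIdx N
  · rw [if_pos hb, if_neg fun h => (mem_interiorIdx_iff hm).1 h hb]; ring
  · rw [if_neg hb, if_pos ((mem_interiorIdx_iff hm).2 hb)]; ring

/-- The discrete Laplacian along the orthogonal directions `a`, `rot a`. -/
def crossLap (a : Plane) (v : Plane → ℝ) (x : Plane) : ℝ :=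
  (secDiff v a x + secDiff v (rot a) x) / ‖a‖ ^ 2

/-- The stencils are the crosses along `(1,0)` and `(1,1)`; the squared lengths `h²` and `2h²`
produce their denominators. -/
theorem negLap_comp_gridPoint {L : ℝ} {N : ℕ} (θ : ℝ) (v : Plane → ℝ) (i j : ℤ) :
    negLap (mesh L N) θ (fun i j => v (gridPoint L N i j)) i j =
      -(θ * crossLap (mesh L N • !₂[1, 0]) v (gridPoint L N i j) +
        (1 - θ) * crossLap (mesh L N • !₂[1, 1]) v (gridPoint L N i j)) := by
  set h := mesh L N with hh
  have n1 : ‖h • (!₂[1, 0] : Plane)‖ ^ 2 = h ^ 2 := by rw [norm_sq_eq]; simp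
  have n2 : ‖h • (!₂[1, 1] : Plane)‖ ^ 2 = 2 * h ^ 2 := by rw [norm_sq_eq]; simp; ring
  have g : ∀ (p q : ℝ) (i' j' : ℤ), (i' : ℝ) = i + p → (j' : ℝ) = j + q →
      gridPoint L N i' j' = gridPoint L N i j + !₂[p * h, q * h] := by
    intro p q i' j' h1 h2
    ext l; fin_cases l
    · simp [gridPoint, h1, ← hh]; ring
    · simp [gridPoint, h2, ← hh]; ring
  have s1 : ∀ (w : Plane) (x : Plane), x - w = x + -w := fun w x => sub_eq_add_neg _ _
  simp only [crossLap, n1, n2, secDiff, s1, rot_smul]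
  have v1 : h • (!₂[1, 0] : Plane) = !₂[1 * h, 0 * h] := by ext l; fin_cases l <;> simp
  have v2 : -(h • (!₂[1, 0] : Plane)) = !₂[-1 * h, 0 * h] := by ext l; fin_cases l <;> simp
  have v3 : h • rot !₂[1, 0] = !₂[0 * h, 1 * h] := by ext l; fin_cases l <;> simp [rot]
  have v4 : -(h • rot !₂[1, 0]) = !₂[0 * h, -1 * h] := by ext l; fin_cases l <;> simp [rot]
  have v5 : h • (!₂[1, 1] : Plane) = !₂[1 * h, 1 * h] := by ext l; fin_cases l <;> simp
  have v6 : -(h • (!₂[1, 1] : Plane)) = !₂[-1 * h, -1 * h] := by ext l; fin_cases l <;> simp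
  have v7 : h • rot !₂[1, 1] = !₂[-1 * h, 1 * h] := by ext l; fin_cases l <;> simp [rot]
  have v8 : -(h • rot !₂[1, 1]) = !₂[1 * h, -1 * h] := by ext l; fin_cases l <;> simp [rot]
  rw [v2, v1, v4, v3, v6, v5, v8, v7]
  rw [← g 1 0 (i + 1) j (by push_cast; ring) (by ring),
    ← g (-1) 0 (i - 1) j (by push_cast; ring) (by ring),
    ← g 0 1 i (j + 1) (by ring) (by push_cast; ring),
    ← g 0 (-1) i (j - 1) (by ring) (by push_cast; ring),
    ← g 1 1 (i + 1) (j + 1) (by push_cast; ring) (by push_cast; ring),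
    ← g (-1) (-1) (i - 1) (j - 1) (by push_cast; ring) (by push_cast; ring),
    ← g (-1) 1 (i - 1) (j + 1) (by push_cast; ring) (by push_cast; ring),
    ← g 1 (-1) (i + 1) (j - 1) (by push_cast; ring) (by push_cast; ring)]
  simp only [negLap, negLap1, negLap2]
  ring

theorem gridPoint_mem_frontier {L : ℝ} (hL : 0 < L) {N : ℕ} (hN : 1 ≤ N) {k : ℤ × ℤ}
    (hk : k ∈ boundaryIdx N) : gridPoint L N k.1 k.2 ∈ frontier (closedSquare L) := by
  have hk' : k ∈ nodeIdx N ∧ k.1 * k.2 * (k.1 - N) * (k.2 - N) = 0 := by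
    simpa [boundaryIdx_eq] using hk
  have hmem := gridPoint_mem hL hN hk'.1
  have hNh := mul_mesh (L := L) hN
  refine ⟨subset_closure hmem, fun hint => ?_⟩
  obtain ⟨ε, hε, hball⟩ := Metric.isOpen_iff.1 isOpen_interior _ hint
  have key : ∀ w : Plane, ‖w‖ < ε → gridPoint L N k.1 k.2 + w ∈ closedSquare L := fun w hw =>
    interior_subset (hball (by simpa [dist_eq_norm] using hw))
  have hn : ∀ (l : Fin 2) (t : ℝ), |t| < ε → ‖EuclideanSpace.single l t‖ < ε := by
    intro l t ht; simpa using ht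
  -- An interior point could be moved by `±ε/2` in each coordinate without leaving the square.
  have hcoord : ∀ l, gridPoint L N k.1 k.2 l ≠ L ∧ gridPoint L N k.1 k.2 l ≠ -L := by
    intro l
    have h1 := (key _ (hn l (ε / 2) (by rw [abs_of_pos] <;> linarith)) l).2
    have h2 := (key _ (hn l (-(ε / 2)) (by rw [abs_neg, abs_of_pos] <;> linarith)) l).1
    simp only [PiLp.add_apply, PiLp.single_apply, if_true] at h1 h2
    constructor <;> intro h <;> linarith
  have h0 := hcoord 0
  have h1 := hcoord 1
  simp only [gridPoint, Matrix.cons_val_zero, Matrix.cons_val_one] at h0 h1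
  have e : ∀ p : ℤ, p = N → -L + (p : ℝ) * mesh L N = L := by
    rintro p rfl; push_cast; linarith
  rcases mul_eq_zero.1 hk'.2 with h | h
  · rcases mul_eq_zero.1 h with h | h
    · rcases mul_eq_zero.1 h with h | h
      · exact h0.2 (by simp [h])
      · exact h1.2 (by simp [h])
    · exact h0.1 (e _ (by omega))
  · exact h1.1 (e _ (by omega))

theorem remainderM_eq_remainder {s L : ℝ} (hL : 0 < L) {N : ℕ} (hN : 1 ≤ N) (c00 : ℝ)
    {u g : Plane → ℝ} (h0 : ∀ x ∈ frontier (closedSquare L), u x = 0) :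
    remainderM s L N c00 u g = remainder s L N u g := by
  ext i j
  unfold remainderM
  split_ifs with h
  · rw [h0 _ (gridPoint_mem_frontier hL hN h)]; ring
  · rw [add_zero]

/-! ### Error estimates -/

theorem exists_ae_abs_le_of_memLp_top {g : Plane → ℝ} (hg : MemLp g ⊤ volume) :
    ∃ M : ℝ, 0 ≤ M ∧ ∀ᵐ y, |g y| ≤ M := by
  have h := hg.eLpNorm_lt_top
  rw [eLpNorm_exponent_top] at h
  refine ⟨(eLpNormEssSup g volume).toReal, ENNReal.toReal_nonneg, ?_⟩
  filter_upwards [enorm_ae_le_eLpNormEssSup g volume] with y hy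
  rw [← Real.norm_eq_abs, ← toReal_enorm]
  exact ENNReal.toReal_mono h.ne hy

theorem eq_indicator_add {L : ℝ} {u g : Plane → ℝ} (hg0 : ∀ x ∈ closedSquare L, g x = 0)
    (hug : ∀ x ∉ closedSquare L, u x = g x) : u = (closedSquare L).indicator u + g := by
  ext x
  by_cases hx : x ∈ closedSquare L
  · simp [hx, hg0 x hx]
  · simp [hx, hug x hx]

theorem crossLap_sub (a : Plane) (v w : Plane → ℝ) (x : Plane) :
    crossLap a (fun y => v y - w y) x = crossLap a v x - crossLap a w x := by
  unfold crossLap secDiff; ring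

theorem abs_crossLap_pot_le {s M h : ℝ} (hs : 0 < s) (hs1 : s < 1) {v : Plane → ℝ}
    (hv : AEStronglyMeasurable v) (hM : ∀ᵐ y, |v y| ≤ M)
    (hsupp : Bornology.IsBounded (Function.support v)) (hh : 0 < h) (a x : Plane) :
    |crossLap (h • a) (pot s v) x| ≤ M * h ^ (-2 * s) *
      (((∫ z, |secDiff (kernel s) a z|) + ∫ z, |secDiff (kernel s) (rot a) z|) / ‖a‖ ^ 2) := by
  have k1 := abs_secDiff_pot_le hs hs1 hv hM hsupp (h • a) x
  have k2 := abs_secDiff_pot_le hs hs1 hv hM hsupp (rot (h • a)) x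
  rw [integral_abs_secDiff_kernel_smul hh] at k1
  rw [rot_smul, integral_abs_secDiff_kernel_smul hh, ← rot_smul] at k2
  have e : h ^ (2 - 2 * s) = h ^ (-2 * s) * h ^ 2 := by
    rw [← Real.rpow_natCast h 2, ← Real.rpow_add hh]; congr 1; push_cast; ring
  rw [e] at k1 k2
  unfold crossLap
  rw [abs_div, norm_smul, Real.norm_of_nonneg hh.le, abs_of_nonneg (by positivity : 0 ≤ (h * ‖a‖) ^ 2)]
  refine (div_le_div_of_nonneg_right ((abs_add_le _ _).trans (add_le_add k1 k2))
    (by positivity)).trans (le_of_eq ?_)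
  rw [mul_pow]
  -- For `a = 0` both sides vanish because division by zero gives zero.
  rcases eq_or_ne a 0 with rfl | ha
  · simp
  · have := norm_ne_zero_iff.2 ha
    field_simp

theorem abs_crossLap_le_of_taylor {K α h δ L : ℝ} {u : Plane → ℝ} (hδ : 0 < δ)
    (hK : ∀ x ∈ openSquare (L + δ), ∀ y ∈ openSquare (L + δ),
      |u y - u x - fderiv ℝ u x (y - x)| ≤ K * ‖y - x‖ ^ (1 + α)) (hh : 0 < h) {a x : Plane}
    (hx : x ∈ closedSquare L) (ha : h * ‖a‖ < δ) :
    |crossLap (h • a) u x| ≤ h ^ (α - 1) * (4 * K * ‖a‖ ^ (1 + α) / ‖a‖ ^ 2) := by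
  have key : ∀ e : Plane, ‖e‖ = h * ‖a‖ →
      |secDiff u e x| ≤ 2 * K * (h * ‖a‖) ^ (1 + α) := by
    intro e he
    rw [← he]
    refine abs_secDiff_le_of_taylor hK (closedSquare_subset_openSquare hδ hx)
      (add_mem_openSquare hx (by rwa [he])) ?_
    rw [sub_eq_add_neg]
    exact add_mem_openSquare hx (by rwa [norm_neg, he])
  have n : ‖h • a‖ = h * ‖a‖ := by rw [norm_smul, Real.norm_of_nonneg hh.le]
  have k1 := key (h • a) n
  have k2 := key (rot (h • a)) (by rw [norm_rot, n])
  rw [Real.mul_rpow hh.le (norm_nonneg _)] at k1 k2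
  have e : h ^ (1 + α) = h ^ (α - 1) * h ^ 2 := by
    rw [← Real.rpow_natCast h 2, ← Real.rpow_add hh]; congr 1; push_cast; ring
  rw [e] at k1 k2
  unfold crossLap
  rw [abs_div, n, abs_of_nonneg (by positivity : 0 ≤ (h * ‖a‖) ^ 2)]
  refine (div_le_div_of_nonneg_right ((abs_add_le _ _).trans (add_le_add k1 k2))
    (by positivity)).trans (le_of_eq ?_)
  rw [mul_pow]
  rcases eq_or_ne a 0 with rfl | ha
  · simp
  · have := norm_ne_zero_iff.2 ha
    field_simp; ring

theorem pot_sub {s M₁ M₂ : ℝ} (hs1 : s < 1) {v w : Plane → ℝ}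
    (hv : AEStronglyMeasurable v) (hvM : ∀ᵐ y, |v y| ≤ M₁)
    (hvs : Bornology.IsBounded (Function.support v))
    (hw : AEStronglyMeasurable w) (hwM : ∀ᵐ y, |w y| ≤ M₂)
    (hws : Bornology.IsBounded (Function.support w)) :
    pot s (fun y => v y - w y) = fun x => pot s v x - pot s w x := by
  ext x
  simp only [pot, mul_sub]
  exact integral_sub (integrable_kernel_mul hs1 hv hvM hvs x)
    (integrable_kernel_mul hs1 hw hwM hws x)

/-- The consistency error of the scheme along the directions `a`, `rot a`. -/
theorem exists_abs_fracLap_add_crossLap_le {s L δ α κ M B K : ℝ} (hs : 0 < s) (hs1 : s < 1)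
    (hL : 0 < L) (hδ : 0 < δ) (hα : 2 * s - 1 < α) (hα0 : 0 ≤ α) (hα1 : α ≤ 1)
    {u g : Plane → ℝ} (hg0 : ∀ x ∈ closedSquare L, g x = 0)
    (hug : ∀ x ∉ closedSquare L, u x = g x) (hum : AEStronglyMeasurable u)
    (hgm : AEStronglyMeasurable g) (huM : ∀ᵐ y, |u y| ≤ M)
    (husupp : Bornology.IsBounded (Function.support u))
    (huM' : ∀ x ∈ closedSquare L, |u x| ≤ M) (hK0 : 0 ≤ K)
    (hK : ∀ x ∈ openSquare (L + δ), ∀ y ∈ openSquare (L + δ),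
      |u y - u x - fderiv ℝ u x (y - x)| ≤ K * ‖y - x‖ ^ (1 + α))
    (hB : ∀ x ∈ closedSquare L, ∀ᵐ z, |secDiff u z x| ≤ B * ‖z‖ ^ (1 + α))
    {a : Plane} (ha : a ≠ 0) (ha4 : ‖a‖ ≤ 4) :
    ∃ C : ℝ, ∀ (N : ℕ) (c00 : ℝ), 1 ≤ N → 4 * mesh L N < δ → 0 ≤ c00 →
      c00 ≤ κ * mesh L N ^ (2 - 2 * s) → ∀ x ∈ closedSquare L,
      |fracLap s u x + crossLap (mesh L N • a)
        (fun y => rieszConst 2 (s - 1) * pot s (interp L N u g) y + c00 * u y) x| ≤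
      C * mesh L N ^ (1 + α - 2 * s) := by
  set c := rieszConst 2 (s - 1) with hcdef
  have hc : 0 < c := rieszConst_pos hs hs1
  set J := ((∫ z, |secDiff (kernel s) a z|) + ∫ z, |secDiff (kernel s) (rot a) z|) / ‖a‖ ^ 2
    with hJ
  set D := 4 * K * ‖a‖ ^ (1 + α) / ‖a‖ ^ 2 with hD
  have hD0 : 0 ≤ D := by positivity
  -- The summands are the constants of the truncation, interpolation and correction errors.
  refine ⟨c / 2 * (B * ∫ z, |truncErr s a z| * ‖z‖ ^ (1 + α)) +
    c * (K * 2 ^ (1 + α) * J) + κ * D, fun N c00 hN hNδ hc0 hcκ x hx => ?_⟩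
  have hh := mesh_pos hL hN
  set h := mesh L N with hhdef
  set W := interp L N u g with hW
  have hE : ∀ y, |u y - W y| ≤ K * (2 * h) ^ (1 + α) :=
    abs_sub_interp_le hL hδ hα0 hK0 hK hg0 hug hN
  have hWm : AEStronglyMeasurable W := by
    refine hgm.add ?_
    exact Finset.aestronglyMeasurable_fun_sum _ fun k _ => (aesm_basisFun hL hN k.1 k.2).const_mul _
  have hWM : ∀ᵐ y, |W y| ≤ M + K * (2 * h) ^ (1 + α) := by
    filter_upwards [huM] with y hy
    have h1 := abs_le.1 (hE y)
    have h2 := abs_le.1 hy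
    exact abs_le.2 ⟨by linarith [h1.1, h1.2, h2.1, h2.2], by linarith [h1.1, h1.2, h2.1, h2.2]⟩
  have hWs : Bornology.IsBounded (Function.support W) := by
    refine ((isBounded_closedSquare L).union husupp).subset fun y hy => ?_
    by_contra hcon
    simp only [Set.mem_union, not_or, Function.mem_support, not_not] at hcon
    refine hy ?_
    simp [hW, interp, basisFun_eq_zero_of_notMem hcon.1, ← hug y hcon.1, hcon.2]
  have hds : Bornology.IsBounded (Function.support fun y => u y - W y) := by
    refine (husupp.union hWs).subset fun y hy => ?_
    by_contra hcon
    simp only [Set.mem_union, not_or, Function.mem_support, not_not] at hcon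
    exact hy (by simp [hcon.1, hcon.2])
  have t1 := abs_fracLap_add_le hs hs1 hα hα1 hum huM husupp (huM' x hx) (hB x hx)
    (smul_ne_zero hh.ne' ha)
  rw [integral_truncErr_mul_smul hh] at t1
  have t2 := abs_crossLap_pot_le hs hs1 (hum.sub hWm) (ae_of_all _ hE) hds hh a x
  -- Here `‖a‖ ≤ 4` and `4h < δ` keep the stencil inside the region where `u` is regular.
  have t3 := abs_crossLap_le_of_taylor hδ hK hh (a := a) hx (by nlinarith)
  have e : fracLap s u x + crossLap (h • a) (fun y => c * pot s W y + c00 * u y) x =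
      (fracLap s u x + c * crossLap (h • a) (pot s u) x) -
        c * crossLap (h • a) (pot s fun y => u y - W y) x + c00 * crossLap (h • a) u x := by
    rw [pot_sub hs1 hum huM husupp hWm hWM hWs, crossLap_sub]
    unfold crossLap secDiff; ring
  have p1 : h ^ (1 + α - 2 * s) = h ^ (1 + α) * h ^ (-2 * s) := by
    rw [← Real.rpow_add hh]; congr 1; ring
  have p2 : h ^ (1 + α - 2 * s) = h ^ (2 - 2 * s) * h ^ (α - 1) := by
    rw [← Real.rpow_add hh]; congr 1; ring
  have b1 : |c * crossLap (h • a) (pot s fun y => u y - W y) x| ≤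
      c * (K * 2 ^ (1 + α) * J) * h ^ (1 + α - 2 * s) := by
    rw [abs_mul, abs_of_pos hc, p1]
    refine (mul_le_mul_of_nonneg_left t2 hc.le).trans (le_of_eq ?_)
    rw [Real.mul_rpow zero_le_two hh.le]; ring
  have b2 : |c00 * crossLap (h • a) u x| ≤ κ * D * h ^ (1 + α - 2 * s) := by
    rw [abs_mul, abs_of_nonneg hc0, p2]
    calc c00 * |crossLap (h • a) u x| ≤ c00 * (h ^ (α - 1) * D) := by gcongr
      _ ≤ κ * h ^ (2 - 2 * s) * (h ^ (α - 1) * D) := by gcongr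
      _ = _ := by ring
  rw [e]
  refine (abs_add_le _ _).trans ((add_le_add ((abs_sub _ _).trans (add_le_add t1 b1)) b2).trans
    (le_of_eq ?_))
  ring

/-! ### Discrete norms -/

theorem normSup_le {N : ℕ} {e : ℤ → ℤ → ℝ} {C : ℝ} (hC : 0 ≤ C)
    (h : ∀ i j, (i, j) ∈ interiorIdx N → |e i j| ≤ C) : normSup N e ≤ C :=
  (pi_norm_le_iff_of_nonneg hC).2 fun k => h _ _ k.2

/-- There are at most `N²` interior nodes and `N h = 2L`. -/
theorem normTwo_le {L : ℝ} (hL : 0 < L) {N : ℕ} (hN : 1 ≤ N) {e : ℤ → ℤ → ℝ} {C : ℝ}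
    (hC : 0 ≤ C) (h : ∀ i j, (i, j) ∈ interiorIdx N → |e i j| ≤ C) :
    normTwo (mesh L N) N e ≤ 2 * L * C := by
  unfold normTwo
  refine Real.sqrt_le_iff.2 ⟨by positivity, ?_⟩
  have h1 : ∑ k ∈ interiorIdx N, e k.1 k.2 ^ 2 ≤ (interiorIdx N).card • C ^ 2 := by
    refine Finset.sum_le_card_nsmul _ _ _ fun k hk => ?_
    rw [← sq_abs]
    exact pow_le_pow_left₀ (abs_nonneg _) (h _ _ hk) 2
  have h2 : ((interiorIdx N).card : ℝ) ≤ (N : ℝ) ^ 2 := by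
    have : (interiorIdx N).card ≤ N ^ 2 := by
      rw [interiorIdx, Finset.card_product, Int.card_Icc, sq]
      exact Nat.mul_le_mul (by omega) (by omega)
    exact_mod_cast this
  calc mesh L N ^ 2 * ∑ k ∈ interiorIdx N, e k.1 k.2 ^ 2
      ≤ mesh L N ^ 2 * ((N : ℝ) ^ 2 * C ^ 2) := by
        refine mul_le_mul_of_nonneg_left (h1.trans ?_) (sq_nonneg _)
        rw [nsmul_eq_mul]
        exact mul_le_mul_of_nonneg_right h2 (sq_nonneg _)
    _ = (N * mesh L N) ^ 2 * C ^ 2 := by ring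
    _ = (2 * L * C) ^ 2 := by rw [mul_mesh hN]; ring

end FracLap2D

end

/-! ### The consistency theorem -/

theorem mainTheorem9
    (s L δ α κ : ℝ) (hs : s ∈ Set.Ioo (0 : ℝ) (1 / 2) ∪ Set.Ioo (1 / 2 : ℝ) 1)
    (hL : 0 < L) (hδ : 0 < δ) (hα : α ∈ Set.Ioc (max 0 (2 * s - 1)) 1)
    (u g : FracLap2D.Plane → ℝ)
    (hg0 : ∀ x ∈ FracLap2D.closedSquare L, g x = 0)
    (hg : MemLp g ⊤ volume)
    (hgsupp : Bornology.IsBounded (Function.support g))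
    (hug : ∀ x ∉ FracLap2D.closedSquare L, u x = g x)
    (hu : FracLap2D.C1Holder α u (FracLap2D.openSquare (L + δ))) :
    ∃ f : FracLap2D.Plane → ℝ,
      (∀ x ∈ FracLap2D.closedSquare L, FracLap2D.HasFracLaplacian s u x (f x)) ∧
      ∃ C : ℝ, 0 < C ∧
        ∀ (N : ℕ) (h θ c00 : ℝ), 1 ≤ N → h = FracLap2D.mesh L N → 4 * h < δ →
          θ ∈ Set.Icc (0 : ℝ) 1 → 0 ≤ c00 → c00 ≤ κ * h ^ (2 - 2 * s) →
          -- the scheme with the correction applied at all grid nodes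
          (FracLap2D.normSup N (fun i j => f (FracLap2D.gridPoint L N i j) -
              FracLap2D.schemeM s L N θ c00 u (FracLap2D.remainderM s L N c00 u g) i j)
              ≤ C * h ^ (1 + α - 2 * s) ∧
            FracLap2D.normTwo h N (fun i j => f (FracLap2D.gridPoint L N i j) -
              FracLap2D.schemeM s L N θ c00 u (FracLap2D.remainderM s L N c00 u g) i j)
              ≤ C * h ^ (1 + α - 2 * s)) ∧
          -- the scheme with the unmodified boundary term, for zero values on the boundary
          ((∀ x ∈ frontier (FracLap2D.closedSquare L), u x = 0) →
            FracLap2D.normSup N (fun i j => f (FracLap2D.gridPoint L N i j) -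
              FracLap2D.schemeM s L N θ c00 u (FracLap2D.remainder s L N u g) i j)
              ≤ C * h ^ (1 + α - 2 * s) ∧
            FracLap2D.normTwo h N (fun i j => f (FracLap2D.gridPoint L N i j) -
              FracLap2D.schemeM s L N θ c00 u (FracLap2D.remainder s L N u g) i j)
              ≤ C * h ^ (1 + α - 2 * s)) := by
  open FracLap2D in
  obtain ⟨hs0, hs1⟩ : 0 < s ∧ s < 1 := by
    rcases hs with h | h
    · exact ⟨h.1, by linarith [h.2]⟩
    · exact ⟨by linarith [h.1], h.2⟩
  have hα0 : 0 < α := (le_max_left _ _).trans_lt hα.1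
  have hα2 : 2 * s - 1 < α := (le_max_right _ _).trans_lt hα.1
  obtain ⟨K, hK0, hK⟩ := hu.exists_taylor hα0.le (isOpen_openSquare _) (convex_openSquare _)
  have hcont : ContinuousOn u (closedSquare L) :=
    hu.1.continuousOn.mono (closedSquare_subset_openSquare hδ)
  obtain ⟨M₁, hM₁⟩ := (isCompact_closedSquare L).exists_bound_of_continuousOn hcont
  obtain ⟨M₂, hM₂0, hM₂⟩ := exists_ae_abs_le_of_memLp_top hg
  have huM' : ∀ x ∈ closedSquare L, |u x| ≤ max M₁ M₂ := fun x hx =>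
    (hM₁ x hx).trans (le_max_left _ _)
  have huM : ∀ᵐ y, |u y| ≤ max M₁ M₂ := by
    filter_upwards [hM₂] with y hy
    by_cases hyL : y ∈ closedSquare L
    · exact huM' y hyL
    · rw [hug y hyL]; exact hy.trans (le_max_right _ _)
  have hgm : AEStronglyMeasurable g := hg.aestronglyMeasurable
  have hum : AEStronglyMeasurable u := by
    rw [eq_indicator_add hg0 hug]
    exact ((aestronglyMeasurable_indicator_iff (isClosed_closedSquare L).measurableSet).2
      (hcont.aestronglyMeasurable (isClosed_closedSquare L).measurableSet)).add hgm
  have husupp : Bornology.IsBounded (Function.support u) := by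
    refine ((isBounded_closedSquare L).union hgsupp).subset fun y hy => ?_
    by_cases hyL : y ∈ closedSquare L
    · exact Or.inl hyL
    · exact Or.inr (by rwa [Function.mem_support, ← hug y hyL])
  have hB : ∀ x ∈ closedSquare L, ∀ᵐ z, |secDiff u z x| ≤
      (2 * K + 4 * max M₁ M₂ / δ ^ (1 + α)) * ‖z‖ ^ (1 + α) := fun x hx =>
    ae_abs_secDiff_le hδ hα0.le hK0 hK huM hx (huM' x hx)
  have hne : ∀ t : ℝ, (!₂[1, t] : Plane) ≠ 0 := fun t h => by
    have := congrArg (fun z : Plane => z 0) h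
    simp at this
  have hnorm : ∀ t : ℝ, t ^ 2 ≤ 1 → ‖(!₂[1, t] : Plane)‖ ≤ 4 := fun t ht => by
    have : ‖(!₂[1, t] : Plane)‖ ^ 2 ≤ 4 ^ 2 := by rw [norm_sq_eq]; simp; linarith
    exact (pow_le_pow_iff_left₀ (norm_nonneg _) (by norm_num) two_ne_zero).1 this
  obtain ⟨C₁, hC₁⟩ := exists_abs_fracLap_add_crossLap_le (κ := κ) hs0 hs1 hL hδ hα2 hα0.le hα.2
    hg0 hug hum hgm huM husupp huM' hK0 hK hB (hne 0) (hnorm 0 (by norm_num))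
  obtain ⟨C₂, hC₂⟩ := exists_abs_fracLap_add_crossLap_le (κ := κ) hs0 hs1 hL hδ hα2 hα0.le hα.2
    hg0 hug hum hgm huM husupp huM' hK0 hK hB (hne 1) (hnorm 1 (by norm_num))
  -- The factor `1 + 2L` serves both norms, and the final `+ 1` makes the constant strictly
  -- positive.
  refine ⟨fracLap s u, fun x hx => hasFracLaplacian_fracLap hs0 hα2 hum huM (huM' x hx) (hB x hx),
    (|C₁| + |C₂|) * (1 + 2 * L) + 1, by positivity, ?_⟩
  rintro N h θ c00 hN rfl hNδ hθ hc0 hcκ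
  have hh := mesh_pos hL hN
  set P := mesh L N ^ (1 + α - 2 * s) with hP
  have hP0 : 0 < P := Real.rpow_pos_of_pos hh _
  have key : ∀ i j, (i, j) ∈ interiorIdx N → |fracLap s u (gridPoint L N i j) -
      schemeM s L N θ c00 u (remainderM s L N c00 u g) i j| ≤ (|C₁| + |C₂|) * P := by
    intro i j hij
    have hx : gridPoint L N i j ∈ closedSquare L := by
      refine gridPoint_mem hL hN (k := (i, j)) ?_
      rw [interiorIdx_eq] at hij
      exact (Finset.mem_filter.1 hij).1
    have k1 := hC₁ N c00 hN hNδ hc0 hcκ _ hx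
    have k2 := hC₂ N c00 hN hNδ hc0 hcκ _ hx
    rw [schemeM_eq hs1 hL hgm hM₂ hgsupp hN θ c00 hij, negLap_comp_gridPoint θ
      fun y => rieszConst 2 (s - 1) * pot s (interp L N u g) y + c00 * u y]
    set F := fracLap s u (gridPoint L N i j)
    set T₁ := crossLap (mesh L N • !₂[1, 0])
      (fun y => rieszConst 2 (s - 1) * pot s (interp L N u g) y + c00 * u y) (gridPoint L N i j)
    set T₂ := crossLap (mesh L N • !₂[1, 1])
      (fun y => rieszConst 2 (s - 1) * pot s (interp L N u g) y + c00 * u y) (gridPoint L N i j)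
    -- The weights sum to one, so the error is a convex combination of the two stencil errors and
    -- the bound is uniform in `θ`.
    have e : F - -(θ * T₁ + (1 - θ) * T₂) = θ * (F + T₁) + (1 - θ) * (F + T₂) := by ring
    rw [e]
    refine (abs_add_le _ _).trans ?_
    rw [abs_mul, abs_mul, abs_of_nonneg hθ.1, abs_of_nonneg (sub_nonneg.2 hθ.2), add_mul]
    refine add_le_add ?_ ?_
    · calc θ * |F + T₁| ≤ 1 * |F + T₁| := by gcongr; exact hθ.2
        _ ≤ C₁ * P := by rw [one_mul]; exact k1
        _ ≤ |C₁| * P := by gcongr; exact le_abs_self _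
    · calc (1 - θ) * |F + T₂| ≤ 1 * |F + T₂| := by gcongr; linarith [hθ.1]
        _ ≤ C₂ * P := by rw [one_mul]; exact k2
        _ ≤ |C₂| * P := by gcongr; exact le_abs_self _
  have hQ : 0 ≤ (|C₁| + |C₂|) * P := by positivity
  have main : normSup N (fun i j => fracLap s u (gridPoint L N i j) -
        schemeM s L N θ c00 u (remainderM s L N c00 u g) i j) ≤
          ((|C₁| + |C₂|) * (1 + 2 * L) + 1) * P ∧
      normTwo (mesh L N) N (fun i j => fracLap s u (gridPoint L N i j) -
        schemeM s L N θ c00 u (remainderM s L N c00 u g) i j) ≤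
          ((|C₁| + |C₂|) * (1 + 2 * L) + 1) * P := by
    refine ⟨(normSup_le hQ key).trans ?_, (normTwo_le hL hN hQ key).trans ?_⟩ <;>
      nlinarith [mul_nonneg hL.le hQ]
  refine ⟨main, fun h0 => ?_⟩
  -- With zero boundary values the boundary correction vanishes and the two schemes coincide.
  rw [remainderM_eq_remainder hL hN c00 h0] at main
  exact main
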